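/- **Setting.** Let $H\in(0,1)$ and let $X=\{X(x)\}_{x\in\mathbb R^2}$ be a centered real Gaussian field with continuous covariance function, with stationary increments ($\{X(x+h)-X(x)\}_h$ and $\{X(h)\}_h$ have the same finite dimensional distributions for every $x$), and $H$-self-similar ($\{X(cx)\}_x$ and $\{c^HX(x)\}_x$ have the same finite dimensional distributions for every $c>0$). Suppose that $X$ has a spectral density, i.e. a measurable $f_X\ge 0$ with $\int_{\mathbb R^2}\min(1,\|\xi\|^2)f_X(\xi)\,d\xi<\infty$ and $$\mathbb E[X(x)X(y)]=\int_{\mathbb R^2}(e^{i\langle x,\xi\rangle}-1)(e^{-i\langle y,\xi\rangle}-1)f_X(\xi)\,d\xi\qquad(x,y\in\mathbb R^2).$$ An anisotropy function of $X$ is a measurable $S_X:\mathbb S^1\to[0,\infty)$ with $f_X(\xi)=\|\xi\|^{-2H-2}S_X(\xi/\|\xi\|)$ for almost every $\xi$. Let $N\ge 0$ and let $\varphi:[0,\infty)\to\mathbb R$ be a radial frequency profile: $\varphi$ is of class $C^2$ on $[0,\infty)$ and of class $C^N$ at $0$, $\varphi(r)=0$ for $r>\pi$, $\sum_{j\in\mathbb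 Z}|\varphi(2^jr)|^2=1$ for all $r>0$, and $\varphi^{(n)}(0)=0$ for $0\le n\le N$. Let $\psi\in L^2(\mathbb R^2)$ be the isotropic wavelet with $\widehat\psi(\xi)=\varphi(\|\xi\|)$, where $\widehat g(\xi)=\int g(x)e^{-i\langle x,\xi\rangle}dx$; let $\mathcal R_\ell$ ($\ell=1,2$) be the Riesz transforms, $\widehat{\mathcal R_\ell g}(\xi)=i\frac{\xi_\ell}{\|\xi\|}\widehat g(\xi)$ for $g \in L^2(\mathbb R^2)$; and for $i\in\mathbb Z$, $k\in\mathbb Z^2$ put $(\mathcal R_\ell\psi)_{i,k}(x)=2^i(\mathcal R_\ell\psi)(2^ix-k)$. The Riesz wavelet coefficients of $X$ are $$c^{(\mathcal R)}_{i,k}(X)=\bigl(c^{(1)}_{i,k},c^{(2)}_{i,k}\bigr),\qquad c^{(\ell)}_{i,k}=\langle X,(\mathcal R_\ell\psi)_{i,k}\rangle=\int_{\mathbb R^2}X(x)\,\overline{(\mathcal R_\ell\psi)_{i,k}(x)}\,dx,$$ the integral being the Bochner integral of an $L^2(\Omega)$-valued function. **Theorem.** An anisotropy function $S_X$ of $X$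 exists. For every anisotropy function $S_X$ of $X$, $S_X$ is integrable on $\mathbb S^1$ with respect to arc length $d\Theta$, and the structure tensor $$J(X)_{\ell_1\ell_2}=\int_{\mathbb S^1}\Theta_{\ell_1}\Theta_{\ell_2}S_X(\Theta)\,d\Theta,\qquad \ell_1,\ell_2\in\{1,2\},$$ which depends only on $S_X$, is a non-negative definite $2\times2$ matrix. For every profile $\varphi$ as above and all $i\in\mathbb Z$, $k\in\mathbb Z^2$, the coefficients are well defined: the functions $x\mapsto X(x)\overline{(\mathcal R_\ell\psi)_{i,k}(x)}$ are Bochner integrable with values in $L^2(\Omega)$; and $c^{(\mathcal R)}_{i,k}(X)$ is almost surely real and a centered Gaussian vector. Moreover $0<\int_0^\infty\frac{|\varphi(r)|^2}{r^{2H+1}}\,dr<\infty$, and the covariance matrix of the coefficients is $$\Sigma\bigl(c^{(\mathcal R)}_{i,k}(X)\bigr)=\mathbb E\Bigl[c^{(\mathcal R)}_{i,k}(X)\,c^{(\mathcal R)}_{i,k}(X)^*\Bigr]=2^{-2i(H+1)}\left(\int_0^\infty\frac{|\varphi(r)|^2}{r^{2H+1}}\,dr\right)J(X).$$ Consequently the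 orientations, i.e. the unit eigenvectors for the largest eigenvalue, of $J(X)$ and of $\Sigma(c^{(\mathcal R)}_{i,k}(X))$ are the same, for every wavelet $\psi$ and all $i$, $k$: the structure tensor and the orientation depend neither on the wavelet nor on the scale. -/

import Mathlib

open MeasureTheory ProbabilityTheory FourierTransform Set ComplexConjugate

noncomputable section

/-- The Euclidean plane `ℝ²`. -/
abbrev Plane : Type := EuclideanSpace ℝ (Fin 2)

/-- The unit circle of the plane. -/
abbrev Circle1 : Type := Metric.sphere (0 : Plane) 1

/-- Arc length on the unit circle (total mass `2π`). -/
abbrev arcLength : Measure Circle1 := (volume : Measure Plane).toSphere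

/-- The Hilbert space `L²(ℝ²; ℂ)`. -/
abbrev L2Plane : Type := Lp ℂ 2 (volume : Measure Plane)

/-! ### Gaussian fields -/

section Fields

variable {Ω : Type*} [MeasurableSpace Ω]

/-- A centered real Gaussian field on the plane with continuous covariance function
(i.e. stochastically continuous). -/
structure IsGaussianField (X : Plane → Ω → ℝ) (P : Measure Ω) : Prop where
  gaussian : IsGaussianProcess X P
  centered : ∀ x, ∫ ω, X x ω ∂P = 0
  continuous_cov : Continuous fun p : Plane × Plane => ∫ ω, X p.1 ω * X p.2 ω ∂P

/-- Two fields have the same finite dimensional distributions. -/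
def SameFDD (X Y : Plane → Ω → ℝ) (P : Measure Ω) : Prop :=
  ∀ I : Finset Plane,
    IdentDistrib (fun ω (h : I) => X h ω) (fun ω (h : I) => Y h ω) P P

/-- Stationary increments: `{X(x+h) - X(x)}_h` and `{X(h)}_h` have the same law. -/
def HasStationaryIncrements (X : Plane → Ω → ℝ) (P : Measure Ω) : Prop :=
  ∀ x : Plane, SameFDD (fun h ω => X (x + h) ω - X x ω) X P

/-- `H`-self-similarity: `{X(cx)}_x` and `{c^H X(x)}_x` have the same law for all `c > 0`. -/
def IsSelfSimilar (H : ℝ) (X : Plane → Ω → ℝ) (P : Measure Ω) : Prop :=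
  ∀ c : ℝ, 0 < c → SameFDD (fun x => X (c • x)) (fun x ω => c ^ H * X x ω) P

/-- `σ` is the spectral measure of the field `X`:
`∫ min(1,‖ξ‖²) dσ < ∞` and `E[X(x)X(y)] = ∫ (e^{i⟨x,ξ⟩} - 1)(e^{-i⟨y,ξ⟩} - 1) dσ(ξ)`. -/
structure IsSpectralMeasure (X : Plane → Ω → ℝ) (P : Measure Ω) (σ : Measure Plane) :
    Prop where
  finite : ∫⁻ ξ, ENNReal.ofReal (min 1 (‖ξ‖ ^ 2)) ∂σ < ⊤
  covariance : ∀ x y : Plane, ((∫ ω, X x ω * X y ω ∂P : ℝ) : ℂ) =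
    ∫ ξ, (Complex.exp (Complex.I * (inner ℝ x ξ : ℝ)) - 1) *
      (Complex.exp (-(Complex.I * (inner ℝ y ξ : ℝ))) - 1) ∂σ

/-- `f` is a spectral density of `X`: the measure `f(ξ) dξ` is the spectral measure of `X`. -/
structure IsSpectralDensity (X : Plane → Ω → ℝ) (P : Measure Ω) (f : Plane → ℝ) : Prop where
  measurable : Measurable f
  nonneg : ∀ ξ, 0 ≤ f ξ
  spectral : IsSpectralMeasure X P (volume.withDensity fun ξ => ENNReal.ofReal (f ξ))

theorem IsGaussianField.memLp {X : Plane → Ω → ℝ} {P : Measure Ω}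
    (hX : IsGaussianField X P) (x : Plane) : MemLp (fun ω => ((X x ω : ℝ) : ℂ)) 2 P :=
  ((hX.gaussian.hasGaussianLaw_eval x).memLp_two).ofReal

/-- The field `x ↦ X(x)` as a map with values in `L²(Ω; ℂ)`. -/
def IsGaussianField.toL2 {X : Plane → Ω → ℝ} {P : Measure Ω}
    (hX : IsGaussianField X P) (x : Plane) : Lp ℂ 2 P :=
  (hX.memLp x).toLp _

/-- The random variable `⟨X, g⟩ = ∫ X(x) conj(g(x)) dx`, a Bochner integral in `L²(Ω; ℂ)`. -/
def IsGaussianField.pairing {X : Plane → Ω → ℝ} {P : Measure Ω}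
    (hX : IsGaussianField X P) (g : Plane → ℂ) : Lp ℂ 2 P :=
  ∫ x, conj (g x) • hX.toL2 x

end Fields

/-- `S` is an anisotropy function associated with the spectral density `f`:
`f(ξ) = ‖ξ‖^{-2H-2} S(ξ/‖ξ‖)` for almost every `ξ`. -/
structure IsAnisotropyFunction (H : ℝ) (f : Plane → ℝ) (S : Circle1 → ℝ) : Prop where
  measurable : Measurable S
  nonneg : ∀ Θ, 0 ≤ S Θ
  eq : ∀ᵐ ξ : Plane, ∀ Θ : Circle1, ξ = ‖ξ‖ • (Θ : Plane) →
    f ξ = ‖ξ‖ ^ (-2 * H - 2) * S Θ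

/-- The structure tensor `J_{ab} = ∫_{S¹} Θ_a Θ_b S(Θ) dΘ`. -/
def structureTensor (S : Circle1 → ℝ) : Matrix (Fin 2) (Fin 2) ℝ :=
  Matrix.of fun a b => ∫ Θ, (Θ : Plane) a * (Θ : Plane) b * S Θ ∂arcLength

/-- `n` is a unit eigenvector of `M` for its largest eigenvalue. -/
def IsOrientation (M : Matrix (Fin 2) (Fin 2) ℝ) (n : Plane) : Prop :=
  ‖n‖ = 1 ∧ ∃ l : ℝ, IsGreatest {m : ℝ | Module.End.HasEigenvalue (Matrix.toLin' M) m} l ∧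
    M.mulVec n.ofLp = l • n.ofLp

/-! ### The Riesz transform and the isotropic wavelet frame -/

/-- The symbol `i ξ_ℓ / ‖ξ‖` of the Riesz transform. -/
def rieszSymbol (l : Fin 2) (ξ : Plane) : ℂ := Complex.I * ((ξ l / ‖ξ‖ : ℝ) : ℂ)

theorem rieszSymbol_memLp (l : Fin 2) (f : L2Plane) :
    MemLp (fun ξ => rieszSymbol l ξ * f ξ) 2 volume := by
  refine (Lp.memLp f).of_le ?_ (Filter.Eventually.of_forall fun ξ => ?_)
  · refine AEStronglyMeasurable.mul (Measurable.aestronglyMeasurable ?_)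
      (Lp.aestronglyMeasurable f)
    unfold rieszSymbol
    fun_prop
  · rw [norm_mul]
    refine mul_le_of_le_one_left (norm_nonneg _) ?_
    simp only [rieszSymbol, norm_mul, Complex.norm_I, one_mul, Complex.norm_real, norm_div,
      norm_norm]
    exact div_le_one_of_le₀ (PiLp.norm_apply_le ξ l) (norm_nonneg _)

/-- The `ℓ`-th component of the Riesz transform of an `L²` function. The symbol is homogeneous of
degree `0`, so that the normalization of the Fourier transform is irrelevant. -/
def rieszTransform (l : Fin 2) (f : L2Plane) : L2Plane :=
  𝓕⁻ ((rieszSymbol_memLp l (𝓕 f)).toLp _)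

/-- The radial frequency profile of an isotropic wavelet with vanishing moments up to order `N`;
only the values `φ(r)` with `r ≥ 0` matter. -/
structure IsRadialProfile (N : ℕ) (φ : ℝ → ℝ) : Prop where
  smooth : ContDiffOn ℝ 2 φ (Ici 0)
  smooth_zero : ContDiffWithinAt ℝ N φ (Ici 0) 0
  support : ∀ r, Real.pi < r → φ r = 0
  partition : ∀ r, 0 < r → HasSum (fun j : ℤ => φ ((2 : ℝ) ^ j * r) ^ 2) 1
  vanishing : ∀ n ≤ N, iteratedDerivWithin n φ (Ici 0) 0 = 0

theorem IsRadialProfile.memLp {N : ℕ} {φ : ℝ → ℝ} (hφ : IsRadialProfile N φ) :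
    MemLp (fun η : Plane => ((φ (2 * Real.pi * ‖η‖) : ℝ) : ℂ)) 2 volume := by
  have hc : Continuous fun η : Plane => ((φ (2 * Real.pi * ‖η‖) : ℝ) : ℂ) := by
    refine Complex.continuous_ofReal.comp ?_
    exact hφ.smooth.continuousOn.comp_continuous (by fun_prop)
      (fun η => mem_Ici.2 (by positivity))
  refine hc.memLp_of_hasCompactSupport ?_
  refine HasCompactSupport.intro (isCompact_closedBall (0 : Plane) 1) fun η hη => ?_
  have h1 : 1 < ‖η‖ := by simpa using hη
  rw [hφ.support _ (by nlinarith [Real.pi_pos]), Complex.ofReal_zero]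

/-- The isotropic mother wavelet `ψ`, i.e. `∫ ψ(x) e^{-i⟨x,ξ⟩} dx = φ(‖ξ‖)`. The Fourier
transform `𝓕` of Mathlib has the kernel `e^{-2πi⟨x,η⟩}`, whence `𝓕 ψ(η) = φ(2π‖η‖)`. -/
def motherWavelet {N : ℕ} {φ : ℝ → ℝ} (hφ : IsRadialProfile N φ) : L2Plane :=
  𝓕⁻ (hφ.memLp.toLp _)

/-- The Riesz wavelets `(R_ℓ ψ)_{i,k}(x) = 2^i (R_ℓ ψ)(2^i x - k)`. -/
def rieszWavelet {N : ℕ} {φ : ℝ → ℝ} (hφ : IsRadialProfile N φ) (i : ℤ) (k : Fin 2 → ℤ)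
    (l : Fin 2) (x : Plane) : ℂ :=
  (2 : ℂ) ^ i *
    rieszTransform l (motherWavelet hφ) ((2 : ℝ) ^ i • x - WithLp.toLp 2 fun j => (k j : ℝ))

/-! ### The Riesz wavelet coefficients of a Gaussian field -/

section Coefficients

variable {Ω : Type*} [MeasurableSpace Ω]

/-- The Riesz wavelet coefficient `c^{(ℓ)}_{i,k}(X) = ⟨X, (R_ℓ ψ)_{i,k}⟩`. -/
def rieszCoeff {X : Plane → Ω → ℝ} {P : Measure Ω} (hX : IsGaussianField X P)
    {N : ℕ} {φ : ℝ → ℝ} (hφ : IsRadialProfile N φ) (i : ℤ) (k : Fin 2 → ℤ) (l : Fin 2) :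
    Lp ℂ 2 P :=
  hX.pairing (rieszWavelet hφ i k l)

/-- The matrix `E[c c^*]` of the vector `c` of Riesz wavelet coefficients of index `(i,k)`. -/
def rieszCovariance {X : Plane → Ω → ℝ} {P : Measure Ω} (hX : IsGaussianField X P)
    {N : ℕ} {φ : ℝ → ℝ} (hφ : IsRadialProfile N φ) (i : ℤ) (k : Fin 2 → ℤ) :
    Matrix (Fin 2) (Fin 2) ℂ :=
  Matrix.of fun a b => ∫ ω, rieszCoeff hX hφ i k a ω * conj (rieszCoeff hX hφ i k b ω) ∂P

end Coefficients

end

/-! Testing `X` against a real wavelet `w` turns the spectral representation into a covariance `∫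
T_a conj(T_b) f dξ` with `T(ξ) = ∫ w(x) (e^{i⟨x,ξ⟩} - 1) dx`. Wavelets have mean zero, so `T` is
their Fourier transform: a phase carrying `k`, times `2^{-i} (ξ_l/‖ξ‖) φ(2^{-i}‖ξ‖)`. The phases
cancel in the product. Since `f` is homogeneous of degree `-2H-2`, polar coordinates separate an
angular integral, the structure tensor, from a radial one, in which a dilation produces the power of
`2`. The factor is positive, so orientations agree.

Three points need work. Integrability: self-similarity gives `‖X(x)‖ ≤ C (1+‖x‖)^H` in `L²(Ω)`, so
the wavelet must be integrable against this weight, although its multiplier need not be smooth at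
the origin. As `φ` is `C²` with `φ(0) = 0`, the multiplier has second differences `O(t²)`
(`exists_second_difference_bound`); Plancherel puts `x_j²` times the kernel in `L²`, and
Cauchy–Schwarz concludes because `H < 1`.

Existence of `S`: the covariance determines the characteristic functions of the finite measures
`|e^{i⟨x,ξ⟩} - 1|² f dξ`, hence `f` (`IsSpectralDensity.ae_eq`). By self-similarity `c^{2H+2} f(cξ)`
is also a spectral density, so `‖ξ‖^{2H+2} f` is invariant almost everywhere under each dilation,
and Fubini makes it a function of the direction.

Gaussianity: the coefficients lie in the closed span of the field in `L²(Ω)`, on which the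
identities `E Z = 0` and `E e^{iZ} = e^{-‖Z‖²/2}` persist by continuity. -/

/-! ### The Fourier transform on `L¹ ∩ L²` -/

section FourierLp

variable {V : Type*} [NormedAddCommGroup V] [InnerProductSpace ℝ V] [FiniteDimensional ℝ V]
  [MeasurableSpace V] [BorelSpace V]

/-- The inverse Fourier integral is continuous. -/
theorem continuous_fourierInv_of_integrable {m : V → ℂ} (hm : Integrable m) :
    Continuous (𝓕⁻ m) := by
  have h : 𝓕⁻ m = fun x => 𝓕 m (-x) := funext fun x => Real.fourierInv_eq_fourier_neg m x
  rw [h]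
  exact (VectorFourier.fourierIntegral_continuous Real.continuous_fourierChar
    (L := innerₗ V) continuous_inner hm).comp continuous_neg

/-- The inverse Fourier integral is self-adjoint. -/
theorem integral_fourierInv_smul_eq_of_integrable {f g : V → ℂ} (hf : Integrable f)
    (hg : Integrable g) : ∫ ξ, 𝓕⁻ f ξ • g ξ = ∫ x, f x • 𝓕⁻ g x := by
  -- `𝓕⁻` is the Fourier integral for the pairing `-innerₗ V`; this pairing is symmetric, so the
  -- flip in the general duality formula disappears.
  have hL : Continuous fun p : V × V => (-innerₗ V) p.1 p.2 :=
    (continuous_inner (𝕜 := ℝ) (E := V)).neg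
  have h := VectorFourier.integral_fourierIntegral_smul_eq_flip (L := -innerₗ V)
    Real.continuous_fourierChar hL hf hg
  have h2 : (-innerₗ V).flip = -innerₗ V := by
    ext x y
    simp [real_inner_comm]
  rw [h2] at h
  exact h

/-- On `L¹ ∩ L²` the inverse Fourier transform of `L²` is given by the inverse Fourier
integral. -/
theorem fourierInv_toLp_ae_eq {m : V → ℂ} (h1 : Integrable m) (h2 : MemLp m 2 volume) :
    ((𝓕⁻ (h2.toLp m) : Lp ℂ 2 (volume : Measure V)) : V → ℂ) =ᵐ[volume] 𝓕⁻ m := by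
  -- Both sides are tested against smooth compactly supported functions. The `L²` transform moves
  -- onto the test function through tempered distributions, the integral one by self-adjointness.
  refine ae_eq_of_integral_contDiff_smul_eq
    ((Lp.memLp (𝓕⁻ (h2.toLp m))).locallyIntegrable (by norm_num))
    (continuous_fourierInv_of_integrable h1).locallyIntegrable fun g hg hgc => ?_
  have hg₁ : HasCompactSupport (Complex.ofRealCLM ∘ g) := hgc.comp_left rfl
  have hg₂ : ContDiff ℝ ((⊤ : ℕ∞) : WithTop ℕ∞) (Complex.ofRealCLM ∘ g) :=
    Complex.ofRealCLM.contDiff.comp hg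
  set G := hg₁.toSchwartzMap hg₂ with hG
  have h3 := congrArg (fun T => T G) (Lp.fourierInv_toTemperedDistribution_eq (h2.toLp m))
  simp only [TemperedDistribution.fourierInv_apply, Lp.toTemperedDistribution_apply] at h3
  have h4 : ∀ u : V → ℂ, ∫ x, g x • u x = ∫ x, G x • u x := fun u => by
    refine integral_congr_ae (Filter.Eventually.of_forall fun x => ?_)
    simp [hG]
  rw [h4, h4, ← h3]
  have h5 : ∫ x, (𝓕⁻ G) x • (h2.toLp m) x = ∫ x, (𝓕⁻ G) x • m x := by
    refine integral_congr_ae ?_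
    filter_upwards [h2.coeFn_toLp] with x hx
    rw [hx]
  rw [h5, SchwartzMap.fourierInv_coe]
  exact integral_fourierInv_smul_eq_of_integrable G.integrable h1

end FourierLp

/-! ### Second differences of homogeneous multiples of radial functions -/

/-- A bound on the second derivative bounds the second differences. -/
theorem abs_second_difference_le {F F1 F2 : ℝ → ℝ} {C : ℝ} (h1 : ∀ s, HasDerivAt F (F1 s) s)
    (h2 : ∀ s, HasDerivAt F1 (F2 s) s) (hC : ∀ s, |F2 s| ≤ C) (a t : ℝ) :
    |F (a + t) + F (a - t) - 2 * F a| ≤ 2 * C * t ^ 2 := by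
  have hF1 : ∀ x y, |F1 x - F1 y| ≤ C * |x - y| := fun x y =>
    convex_univ.norm_image_sub_le_of_norm_hasDerivWithin_le (f := F1) (f' := F2)
      (fun s _ => (h2 s).hasDerivWithinAt) (fun s _ => hC s) (mem_univ y) (mem_univ x)
  have hC0 : 0 ≤ C := (abs_nonneg _).trans (hC 0)
  -- The mean value inequality is applied to `s ↦ F (a + s) + F (a - s)` on the segment from `0` to
  -- `t`, where its derivative is at most `2 C |t|`.
  have hG : ∀ s, HasDerivAt (fun s => F (a + s) + F (a - s)) (F1 (a + s) - F1 (a - s)) s := by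
    intro s
    have e1 := (h1 (a + s)).comp_const_add a s
    have e2 := (h1 (a - s)).comp_const_sub a s
    exact (e1.add e2).congr_deriv (by ring)
  have hb : ∀ s ∈ uIcc (0 : ℝ) t, ‖F1 (a + s) - F1 (a - s)‖ ≤ 2 * C * |t| := by
    intro s hs
    have hst : |s| ≤ |t| := by
      have := abs_sub_left_of_mem_uIcc hs
      simpa using this
    calc |F1 (a + s) - F1 (a - s)| ≤ C * |(a + s) - (a - s)| := hF1 _ _
      _ = 2 * C * |s| := by
        rw [show (a + s) - (a - s) = 2 * s by ring, abs_mul, abs_two]; ring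
      _ ≤ 2 * C * |t| := by gcongr
  have h := (convex_uIcc (0 : ℝ) t).norm_image_sub_le_of_norm_hasDerivWithin_le
    (fun s _ => (hG s).hasDerivWithinAt) hb left_mem_uIcc right_mem_uIcc
  simp only [add_zero, sub_zero, Real.norm_eq_abs] at h
  rw [show 2 * C * t ^ 2 = 2 * C * |t| * |t| by rw [← sq_abs]; ring,
    show F (a + t) + F (a - t) - 2 * F a = F (a + t) + F (a - t) - (F a + F a) by ring]
  exact h

/-- Derivative bounds for a `C²` function on `[0,∞)` that vanishes at `0` and near infinity. -/
theorem exists_deriv_bounds {q : ℝ → ℝ} {R : ℝ} (hq : ContDiffOn ℝ 2 q (Ici 0))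
    (h0 : q 0 = 0) (hsupp : ∀ r, R < r → q r = 0) :
    ∃ (q1 q2 : ℝ → ℝ) (C : ℝ), 0 ≤ C ∧ ∀ r, 0 < r →
      HasDerivAt q (q1 r) r ∧ HasDerivAt q1 (q2 r) r ∧ |q r| ≤ C * r ∧ |q1 r| ≤ C ∧
      |q2 r| ≤ C ∧ |q r - r * q1 r| ≤ C * r ^ 2 := by
  have hU : UniqueDiffOn ℝ (Ici (0 : ℝ)) := uniqueDiffOn_Ici 0
  set q1 := derivWithin q (Ici 0) with hq1
  set q2 := derivWithin q1 (Ici 0) with hq2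
  have hq1c : ContDiffOn ℝ 1 q1 (Ici 0) := hq.derivWithin hU (by norm_num)
  have hq2c : ContDiffOn ℝ 0 q2 (Ici 0) := hq1c.derivWithin hU (by norm_num)
  have hd1 : ∀ r ∈ Ici (0 : ℝ), HasDerivWithinAt q (q1 r) (Ici 0) r := fun r hr =>
    ((hq.differentiableOn (by norm_num)) r hr).hasDerivWithinAt
  have hd2 : ∀ r ∈ Ici (0 : ℝ), HasDerivWithinAt q1 (q2 r) (Ici 0) r := fun r hr =>
    ((hq1c.differentiableOn (by norm_num)) r hr).hasDerivWithinAt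
  have hz : ∀ u : ℝ → ℝ, (∀ r, R < r → u r = 0) → ∀ r, R < r → derivWithin u (Ici 0) r = 0 := by
    intro u hu r hr
    have he : u =ᶠ[nhdsWithin r (Ici 0)] fun _ => 0 :=
      Filter.Eventually.filter_mono nhdsWithin_le_nhds
        (Filter.eventually_of_mem (Ioi_mem_nhds hr) hu)
    rw [he.derivWithin_eq (hu r hr)]
    simp
  have hz1 : ∀ r, R < r → q1 r = 0 := hz q hsupp
  have hz2 : ∀ r, R < r → q2 r = 0 := hz q1 hz1
  have hsub : Icc 0 R ⊆ Ici (0 : ℝ) := Icc_subset_Ici_self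
  obtain ⟨M1, hM1⟩ := isCompact_Icc.exists_bound_of_continuousOn (hq1c.continuousOn.mono hsub)
  obtain ⟨M2, hM2⟩ := isCompact_Icc.exists_bound_of_continuousOn (hq2c.continuousOn.mono hsub)
  -- Beyond `R` both derivatives vanish, so compactness of `[0, R]` gives global bounds; the `0`
  -- covers an empty interval.
  set C := max 0 (max M1 M2)
  have hC0 : 0 ≤ C := le_max_left _ _
  have hb1 : ∀ r ∈ Ici (0 : ℝ), ‖q1 r‖ ≤ C := by
    intro r hr
    rcases le_or_gt r R with h | h
    · exact (hM1 r ⟨hr, h⟩).trans ((le_max_left _ _).trans (le_max_right _ _))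
    · rw [hz1 r h]; simpa
  have hb2 : ∀ r ∈ Ici (0 : ℝ), ‖q2 r‖ ≤ C := by
    intro r hr
    rcases le_or_gt r R with h | h
    · exact (hM2 r ⟨hr, h⟩).trans ((le_max_right _ _).trans (le_max_right _ _))
    · rw [hz2 r h]; simpa
  refine ⟨q1, q2, C, hC0, fun r hr => ⟨(hd1 r hr.le).hasDerivAt (Ici_mem_nhds hr),
    (hd2 r hr.le).hasDerivAt (Ici_mem_nhds hr), ?_, hb1 r hr.le, hb2 r hr.le, ?_⟩⟩
  · have h := (convex_Ici (0 : ℝ)).norm_image_sub_le_of_norm_hasDerivWithin_le hd1 hb1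
      (mem_Ici.2 le_rfl) (mem_Ici.2 hr.le)
    simpa [h0, abs_of_pos hr] using h
  -- The derivative of `q - s q'` is `-s q''`, of size at most `C r` on `[0, r]`.
  · have hd3 : ∀ s ∈ Icc 0 r, HasDerivWithinAt (fun s => q s - s * q1 s) (-(s * q2 s))
        (Icc 0 r) s := by
      intro s hs
      have hs' : s ∈ Ici (0 : ℝ) := hs.1
      have e := (hd1 s hs').sub ((hasDerivWithinAt_id s (Ici 0)).mul (hd2 s hs'))
      refine (e.mono Icc_subset_Ici_self).congr_deriv ?_
      simp
    have h := (convex_Icc 0 r).norm_image_sub_le_of_norm_hasDerivWithin_le (C := C * r) hd3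
      (fun s hs => by
        rw [norm_neg, norm_mul, mul_comm]
        have : ‖s‖ ≤ r := by rw [Real.norm_eq_abs, abs_of_nonneg hs.1]; exact hs.2
        exact mul_le_mul (hb2 s hs.1) this (norm_nonneg _) hC0)
      (left_mem_Icc.2 hr.le) (right_mem_Icc.2 hr.le)
    simp only [h0, zero_mul, sub_zero, Real.norm_eq_abs, abs_of_pos hr] at h
    calc _ ≤ C * r * r := h
      _ = C * r ^ 2 := by ring

/-- Derivative bounds for the quotient `q(r) / r`. -/
theorem exists_deriv_bounds_div {q : ℝ → ℝ} {R : ℝ} (hq : ContDiffOn ℝ 2 q (Ici 0))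
    (h0 : q 0 = 0) (hsupp : ∀ r, R < r → q r = 0) :
    ∃ (p1 p2 : ℝ → ℝ) (C : ℝ), 0 ≤ C ∧ ∀ r, 0 < r →
      HasDerivAt (fun r => q r / r) (p1 r) r ∧ HasDerivAt p1 (p2 r) r ∧ |p1 r| ≤ C ∧
      r * |p2 r| ≤ C := by
  obtain ⟨q1, q2, C, hC, h⟩ := exists_deriv_bounds hq h0 hsupp
  -- These are the first two derivatives of `q / r`. The estimate on `q - r q'` bounds the first
  -- one; the second may grow like `1 / r`, whence the factor `r` in its bound.
  refine ⟨fun r => (q1 r * r - q r) / r ^ 2,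
    fun r => (q2 r + 2 * ((q r - r * q1 r) / r ^ 2)) / r, 3 * C, by positivity, fun r hr => ?_⟩
  obtain ⟨d1, d2, -, -, b2, b3⟩ := h r hr
  have hr0 : r ≠ 0 := hr.ne'
  have b4 : |(q r - r * q1 r) / r ^ 2| ≤ C := by
    rw [abs_div, abs_of_pos (by positivity : 0 < r ^ 2), div_le_iff₀ (by positivity)]
    exact b3
  refine ⟨?_, ?_, ?_, ?_⟩
  · exact (d1.div (hasDerivAt_id r) hr0).congr_deriv (by simp)
  · have e := ((d2.mul (hasDerivAt_id r)).sub d1).div ((hasDerivAt_id r).pow 2)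
      (pow_ne_zero 2 hr0)
    refine e.congr_deriv ?_
    simp only [id_eq, Pi.sub_apply, Pi.mul_apply, Pi.pow_apply]
    field_simp
    ring
  · have : (q1 r * r - q r) / r ^ 2 = -((q r - r * q1 r) / r ^ 2) := by ring
    simp only [this, abs_neg]
    linarith
  · rw [abs_div, abs_of_pos hr, mul_div_cancel₀ _ hr0]
    calc _ ≤ |q2 r| + |2 * ((q r - r * q1 r) / r ^ 2)| := abs_add_le _ _
      _ ≤ C + 2 * C := by
        rw [abs_mul, abs_two]; gcongr
      _ = 3 * C := by ring

/-- Second differences along a line that avoids the origin. -/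
theorem abs_second_difference_line_le {p p1 p2 : ℝ → ℝ} {C : ℝ} (hC : 0 ≤ C)
    (hp : ∀ r, 0 < r → HasDerivAt p (p1 r) r ∧ HasDerivAt p1 (p2 r) r ∧ |p1 r| ≤ C ∧
      r * |p2 r| ≤ C) {b : ℝ} (hb : b ≠ 0) {α β : ℝ} (hα : |α| ≤ 1) (hβ : |β| ≤ 1) (a t : ℝ) :
    |(α * (a + t) + β * b) * p (√((a + t) ^ 2 + b ^ 2)) +
      (α * (a - t) + β * b) * p (√((a - t) ^ 2 + b ^ 2)) -
      2 * ((α * a + β * b) * p (√(a ^ 2 + b ^ 2)))| ≤ 2 * (6 * C) * t ^ 2 := by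
  set ρ : ℝ → ℝ := fun s => √(s ^ 2 + b ^ 2) with hρ
  have hpos : ∀ s, 0 < s ^ 2 + b ^ 2 := fun s => by positivity
  have hρ0 : ∀ s, 0 < ρ s := fun s => Real.sqrt_pos.2 (hpos s)
  have hρsq : ∀ s, ρ s ^ 2 = s ^ 2 + b ^ 2 := fun s => Real.sq_sqrt (hpos s).le
  have dρ : ∀ s, HasDerivAt ρ (s / ρ s) s := by
    intro s
    have e := (((hasDerivAt_id s).pow 2).add_const (b ^ 2)).sqrt (hpos s).ne'
    refine e.congr_deriv ?_
    have := (hρ0 s).ne'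
    simp only [id_eq, Pi.pow_apply]
    change _ / (2 * ρ s) = _
    field_simp
    norm_num
  have dρ' : ∀ s, HasDerivAt (fun s => s / ρ s) (b ^ 2 / ρ s ^ 3) s := by
    intro s
    refine ((hasDerivAt_id s).div (dρ s) (hρ0 s).ne').congr_deriv ?_
    have := (hρ0 s).ne'
    have h2 : b ^ 2 = ρ s ^ 2 - s ^ 2 := by rw [hρsq]; ring
    simp only [id_eq, h2]
    field_simp
  have du : ∀ s, HasDerivAt (fun s => α * s + β * b) α s := fun s => by
    simpa using ((hasDerivAt_id s).const_mul α).add_const (β * b)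
  -- The linear factor is at most `2 ρ`, which absorbs the `1/ρ` growth of `p2` and of `ρ'' = b² /
  -- ρ³`. The terms of `F2` contribute `C + C + 4 C`, uniformly in `b`.
  refine abs_second_difference_le (F := fun s => (α * s + β * b) * p (ρ s))
    (F1 := fun s => α * p (ρ s) + (α * s + β * b) * (p1 (ρ s) * (s / ρ s)))
    (F2 := fun s => α * (p1 (ρ s) * (s / ρ s)) + (α * (p1 (ρ s) * (s / ρ s)) +
      (α * s + β * b) * (p2 (ρ s) * (s / ρ s) * (s / ρ s) + p1 (ρ s) * (b ^ 2 / ρ s ^ 3))))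
    (fun s => ?_) (fun s => ?_) (fun s => ?_) a t
  · exact (du s).mul ((hp _ (hρ0 s)).1.comp s (dρ s))
  · exact (((hp _ (hρ0 s)).1.comp s (dρ s)).const_mul α).add
      ((du s).mul (((hp _ (hρ0 s)).2.1.comp s (dρ s)).mul (dρ' s)))
  · obtain ⟨-, -, h1, h2⟩ := hp _ (hρ0 s)
    have hs : |s| ≤ ρ s := Real.abs_le_sqrt (by nlinarith [sq_nonneg b])
    have hbρ : |b| ≤ ρ s := Real.abs_le_sqrt (by nlinarith [sq_nonneg s])
    have hsd : |s / ρ s| ≤ 1 := by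
      rw [abs_div, abs_of_pos (hρ0 s)]
      exact div_le_one_of_le₀ hs (hρ0 s).le
    have hu : |α * s + β * b| ≤ 2 * ρ s := by
      calc _ ≤ |α * s| + |β * b| := abs_add_le _ _
        _ ≤ 1 * ρ s + 1 * ρ s := by
          rw [abs_mul, abs_mul]; gcongr
        _ = 2 * ρ s := by ring
    have hX : |p1 (ρ s) * (s / ρ s)| ≤ C := by
      rw [abs_mul]
      exact (mul_le_of_le_one_right (abs_nonneg _) hsd).trans h1
    have hαX : |α * (p1 (ρ s) * (s / ρ s))| ≤ C := by
      rw [abs_mul]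
      exact (mul_le_of_le_one_left (abs_nonneg _) hα).trans hX
    have hY : ρ s * |p2 (ρ s) * (s / ρ s) * (s / ρ s) + p1 (ρ s) * (b ^ 2 / ρ s ^ 3)|
        ≤ 2 * C := by
      have hb2 : ρ s * |b ^ 2 / ρ s ^ 3| ≤ 1 := by
        rw [abs_of_nonneg (div_nonneg (sq_nonneg _) (pow_nonneg (hρ0 s).le _))]
        have h3 : ρ s * (b ^ 2 / ρ s ^ 3) = b ^ 2 / ρ s ^ 2 := by
          have := (hρ0 s).ne'
          field_simp
        rw [h3]
        exact div_le_one_of_le₀ (by rw [hρsq]; nlinarith [sq_nonneg s]) (sq_nonneg _)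
      calc _ ≤ ρ s * (|p2 (ρ s) * (s / ρ s) * (s / ρ s)| + |p1 (ρ s) * (b ^ 2 / ρ s ^ 3)|) :=
            mul_le_mul_of_nonneg_left (abs_add_le _ _) (hρ0 s).le
        _ = ρ s * |p2 (ρ s)| * |s / ρ s| * |s / ρ s| +
            |p1 (ρ s)| * (ρ s * |b ^ 2 / ρ s ^ 3|) := by
          rw [abs_mul, abs_mul, abs_mul (p1 _)]; ring
        _ ≤ C * 1 * 1 + C * 1 := by
          gcongr
        _ = 2 * C := by ring
    calc _ ≤ |α * (p1 (ρ s) * (s / ρ s))| + (|α * (p1 (ρ s) * (s / ρ s))| +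
          |α * s + β * b| *
            |p2 (ρ s) * (s / ρ s) * (s / ρ s) + p1 (ρ s) * (b ^ 2 / ρ s ^ 3)|) := by
          rw [← abs_mul (α * s + β * b)]
          exact (abs_add_le _ _).trans (by gcongr; exact abs_add_le _ _)
      _ ≤ C + (C + 2 * ρ s *
            |p2 (ρ s) * (s / ρ s) * (s / ρ s) + p1 (ρ s) * (b ^ 2 / ρ s ^ 3)|) := by
          gcongr
      _ ≤ C + (C + 2 * (2 * C)) := by
          rw [mul_assoc 2 (ρ s)]; gcongr
      _ = 6 * C := by ring

/-- The real multiplier `η_ℓ q(‖η‖) / ‖η‖`. -/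
noncomputable def directionalProfile (q : ℝ → ℝ) (l : Fin 2) (η : Plane) : ℝ :=
  η l / ‖η‖ * q ‖η‖

theorem abs_directionalProfile_le (q : ℝ → ℝ) (l : Fin 2) (η : Plane) :
    |directionalProfile q l η| ≤ |q ‖η‖| := by
  rw [directionalProfile, abs_mul]
  refine mul_le_of_le_one_left (abs_nonneg _) ?_
  rw [abs_div, abs_norm]
  exact div_le_one_of_le₀ (PiLp.norm_apply_le η l) (norm_nonneg _)

theorem continuous_directionalProfile {q : ℝ → ℝ} (hq : ContinuousOn q (Ici 0)) (h0 : q 0 = 0)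
    (l : Fin 2) : Continuous (directionalProfile q l) := by
  have hqn : Continuous fun η : Plane => q ‖η‖ :=
    hq.comp_continuous continuous_norm fun η => norm_nonneg η
  refine continuous_iff_continuousAt.2 fun η => ?_
  -- The quotient `η l / ‖η‖` has no limit at the origin; there continuity comes from `q 0 = 0`.
  rcases eq_or_ne η 0 with rfl | hη
  · have hz : directionalProfile q l 0 = 0 := by simp [directionalProfile]
    rw [ContinuousAt, hz]
    refine squeeze_zero_norm (fun η => abs_directionalProfile_le q l η) ?_
    have := hqn.abs.tendsto 0
    simpa [h0] using this
  · exact (ContinuousAt.div (by fun_prop) (by fun_prop) (norm_ne_zero_iff.2 hη)).mul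
      hqn.continuousAt

theorem dense_apply_ne_zero (j : Fin 2) : Dense {η : Plane | η j ≠ 0} := by
  have ho : IsOpenMap (EuclideanSpace.proj j : Plane →L[ℝ] ℝ) := by
    refine ContinuousLinearMap.isOpenMap _ fun y => ⟨EuclideanSpace.single j y, by simp⟩
  exact (dense_compl_singleton (0 : ℝ)).preimage ho

/-- The second differences of the multiplier `η_ℓ q(‖η‖) / ‖η‖` in the coordinate directions. -/
theorem exists_second_difference_bound {q : ℝ → ℝ} {R : ℝ}
    (hq : ContDiffOn ℝ 2 q (Ici 0)) (h0 : q 0 = 0) (hsupp : ∀ r, R < r → q r = 0) (l : Fin 2) :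
    ∃ C, 0 ≤ C ∧ ∀ (j : Fin 2) (t : ℝ) (η : Plane),
      |directionalProfile q l (η + EuclideanSpace.single j t) +
        directionalProfile q l (η - EuclideanSpace.single j t) -
        2 * directionalProfile q l η| ≤ C * t ^ 2 := by
  obtain ⟨p1, p2, C, hC, hp⟩ := exists_deriv_bounds_div hq h0 hsupp
  have hcont := continuous_directionalProfile hq.continuousOn h0 l
  refine ⟨2 * (6 * C), by positivity, fun j t η => ?_⟩
  obtain ⟨k, hk⟩ : ∃ k : Fin 2, k ≠ j := exists_ne j
  -- If `η k ≠ 0`, the line through `η` in direction `j` avoids the origin. The bound there is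
  -- uniform and closed in `η`, so density extends it to all lines.
  refine (dense_apply_ne_zero k).induction (P := fun η =>
    |directionalProfile q l (η + EuclideanSpace.single j t) +
        directionalProfile q l (η - EuclideanSpace.single j t) -
        2 * directionalProfile q l η| ≤ 2 * (6 * C) * t ^ 2) (fun η hη => ?_)
    (isClosed_le (by fun_prop) continuous_const) η
  have hnorm : ∀ ζ : Plane, ‖ζ‖ = √(ζ j ^ 2 + ζ k ^ 2) := by
    intro ζ
    rw [EuclideanSpace.norm_eq]
    fin_cases j <;> fin_cases k <;> simp [Fin.sum_univ_two, add_comm] at hk ⊢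
  have hkj : (EuclideanSpace.single j t : Plane) k = 0 := by simp [hk]
  have hform : ∀ ζ : Plane, directionalProfile q l ζ =
      ((if l = j then 1 else 0) * ζ j + (if l = j then 0 else 1) * ζ k) *
        (fun r => q r / r) (√(ζ j ^ 2 + ζ k ^ 2)) := by
    intro ζ
    rw [← hnorm, directionalProfile]
    have hl : l = j ∨ l = k := by omega
    rcases hl with rfl | rfl
    · simp; ring
    · simp [hk]; ring
  have h := abs_second_difference_line_le hC hp hη
    (α := if l = j then 1 else 0) (β := if l = j then 0 else 1)
    (by split_ifs <;> simp) (by split_ifs <;> simp) (η j) t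
  rw [hform, hform, hform]
  simpa [hk] using h

/-! ### Decay of the inverse Fourier transform -/

section FourierDecay

variable {V : Type*} [NormedAddCommGroup V] [InnerProductSpace ℝ V] [FiniteDimensional ℝ V]
  [MeasurableSpace V] [BorelSpace V]

theorem eLpNorm_two_sq {α F : Type*} [MeasurableSpace α] {μ : Measure α} [NormedAddCommGroup F]
    (u : α → F) : eLpNorm u 2 μ ^ 2 = ∫⁻ x, ‖u x‖ₑ ^ 2 ∂μ := by
  have h := eLpNorm_nnreal_pow_eq_lintegral (μ := μ) (f := u) (p := 2) (by norm_num)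
  simpa using h

/-- Plancherel's identity on `L¹ ∩ L²`. -/
theorem lintegral_enorm_fourierInv_sq {m : V → ℂ} (h1 : Integrable m) (h2 : MemLp m 2 volume) :
    ∫⁻ x, ‖𝓕⁻ m x‖ₑ ^ 2 = ∫⁻ x, ‖m x‖ₑ ^ 2 := by
  have hn : ‖(𝓕⁻ (h2.toLp m) : Lp ℂ 2 (volume : Measure V))‖ = ‖h2.toLp m‖ := by
    rw [← Lp.norm_fourier_eq (𝓕⁻ (h2.toLp m)), FourierTransform.fourier_fourierInv_eq]
  have he : eLpNorm (𝓕⁻ m) 2 volume = eLpNorm m 2 volume := by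
    rw [← eLpNorm_congr_ae (fourierInv_toLp_ae_eq h1 h2), ← eLpNorm_congr_ae h2.coeFn_toLp]
    rw [Lp.norm_def, Lp.norm_def] at hn
    exact (ENNReal.toReal_eq_toReal_iff' (Lp.eLpNorm_ne_top _) (Lp.eLpNorm_ne_top _)).1 hn
  rw [← eLpNorm_two_sq, he, eLpNorm_two_sq]

theorem fourierInv_comp_add_right (m : V → ℂ) (v x : V) :
    𝓕⁻ (fun η => m (η + v)) x = Complex.exp ((-(2 * Real.pi * inner ℝ v x) : ℝ) * Complex.I) *
      𝓕⁻ m x := by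
  rw [Real.fourierInv_eq', Real.fourierInv_eq',
    ← integral_add_right_eq_self (fun η =>
      Complex.exp (((2 * Real.pi * inner ℝ η x : ℝ) : ℂ) * Complex.I) • m η) v,
    ← integral_const_mul]
  refine integral_congr_ae (Filter.Eventually.of_forall fun η => ?_)
  simp only [smul_eq_mul]
  rw [← mul_assoc, ← Complex.exp_add, inner_add_left]
  congr 2
  push_cast
  ring

theorem integrable_fourierInv_integrand {m : V → ℂ} (hm : Integrable m) (x : V) :
    Integrable fun η => Complex.exp (((2 * Real.pi * inner ℝ η x : ℝ) : ℂ) * Complex.I) • m η := by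
  have hc : Continuous fun η : V =>
      Complex.exp (((2 * Real.pi * inner ℝ η x : ℝ) : ℂ) * Complex.I) := by fun_prop
  refine hm.norm.mono' (hc.aestronglyMeasurable.smul hm.1)
    (Filter.Eventually.of_forall fun η => ?_)
  rw [norm_smul, Complex.norm_exp_ofReal_mul_I, one_mul]

/-- The shifts by `v` and `-v` produce conjugate phases, which add up to a cosine. For small `⟨v,
x⟩` the resulting factor is comparable to `-⟨v, x⟩²`, so second differences detect quadratic decay.
-/
theorem fourierInv_second_difference {m : V → ℂ} (hm : Integrable m) (v x : V) :
    𝓕⁻ (fun η => m (η + v) + m (η - v) - 2 * m η) x =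
      ((2 * Real.cos (2 * Real.pi * inner ℝ v x) - 2 : ℝ) : ℂ) * 𝓕⁻ m x := by
  have h1 : Integrable fun η => m (η + v) := hm.comp_add_right v
  have h2 : Integrable fun η => m (η + -v) := hm.comp_add_right (-v)
  have e1 := integrable_fourierInv_integrand h1 x
  have e2 := integrable_fourierInv_integrand h2 x
  have e3 := integrable_fourierInv_integrand hm x
  have e : 𝓕⁻ (fun η => m (η + v) + m (η - v) - 2 * m η) x =
      𝓕⁻ (fun η => m (η + v)) x + 𝓕⁻ (fun η => m (η + -v)) x - 2 * 𝓕⁻ m x := by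
    simp only [Real.fourierInv_eq']
    rw [← integral_add e1 e2, ← integral_const_mul]
    refine Eq.trans ?_ (integral_sub (e1.add e2) (e3.const_mul 2))
    refine integral_congr_ae (Filter.Eventually.of_forall fun η => ?_)
    simp only [smul_eq_mul, sub_eq_add_neg]
    ring
  rw [e, fourierInv_comp_add_right, fourierInv_comp_add_right, inner_neg_left]
  push_cast
  rw [Complex.cos]
  simp only [neg_mul, mul_neg, neg_neg]
  ring

/-- Quadratic second differences in the direction `v` yield quadratic decay of the inverse
Fourier transform, in the sense of `L²`. -/
theorem lintegral_enorm_inner_sq_mul_fourierInv_lt_top {m : V → ℂ} (hm : Continuous m) {R C : ℝ}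
    (hsupp : ∀ η, R < ‖η‖ → m η = 0) (v : V)
    (hC : ∀ (t : ℝ) η, ‖m (η + t • v) + m (η - t • v) - 2 * m η‖ ≤ C * t ^ 2) :
    ∫⁻ x, ‖((inner ℝ v x ^ 2 : ℝ) : ℂ) * 𝓕⁻ m x‖ₑ ^ 2 < ⊤ := by
  have hmc : HasCompactSupport m := HasCompactSupport.intro (isCompact_closedBall (0 : V) R)
    fun η hη => hsupp η (by simpa using hη)
  have hmi : Integrable m := hm.integrable_of_hasCompactSupport hmc
  set B : ENNReal := ENNReal.ofReal C ^ 2 * volume (Metric.closedBall (0 : V) (R + ‖v‖)) with hB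
  have hBtop : B < ⊤ := ENNReal.mul_lt_top (by simp) measure_closedBall_lt_top
  -- The bound `B` on each slab does not depend on its width: by Plancherel the second difference
  -- with step `t` costs `t⁴ B`, and the cosine factor on the slab returns at least `t⁴`. Monotone
  -- convergence over the slabs then concludes.
  have key : ∀ n : ℕ, ∫⁻ x in {x | |inner ℝ v x| ≤ (n + 1 : ℕ)},
      ‖((inner ℝ v x ^ 2 : ℝ) : ℂ) * 𝓕⁻ m x‖ₑ ^ 2 ≤ B := by
    intro n
    set N : ℝ := ((n + 1 : ℕ) : ℝ) with hN
    have hN1 : 1 ≤ N := by simp [hN]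
    -- With this step `|2π t ⟨v, x⟩| ≤ π` on the slab, the range of the quadratic upper bound for
    -- the cosine. Also `t ≤ 1`, which keeps the support of `D` in a fixed ball.
    set t : ℝ := 1 / (2 * N) with ht
    have ht0 : 0 < t := by positivity
    have ht1 : t ≤ 1 := by
      rw [ht, div_le_one (by positivity)]; linarith
    set D : V → ℂ := fun η => m (η + t • v) + m (η - t • v) - 2 * m η with hD
    have hDc : Continuous D := by fun_prop
    have hDsupp : ∀ η, R + ‖v‖ < ‖η‖ → D η = 0 := by
      intro η hη
      have htv : ‖t • v‖ ≤ ‖v‖ := by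
        rw [norm_smul, Real.norm_eq_abs, abs_of_pos ht0]
        exact mul_le_of_le_one_left (norm_nonneg _) ht1
      have a1 : R < ‖η + t • v‖ := by
        have := norm_sub_norm_le η (-(t • v))
        rw [sub_neg_eq_add, norm_neg] at this
        linarith
      have a2 : R < ‖η - t • v‖ := by
        have := norm_sub_norm_le η (t • v)
        linarith
      have a3 : R < ‖η‖ := by linarith [norm_nonneg v]
      simp [hD, hsupp _ a1, hsupp _ a2, hsupp _ a3]
    have hDcs : HasCompactSupport D :=
      HasCompactSupport.intro (isCompact_closedBall (0 : V) (R + ‖v‖))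
        fun η hη => hDsupp η (by simpa using hη)
    have hpl := lintegral_enorm_fourierInv_sq (hDc.integrable_of_hasCompactSupport hDcs)
      (hDc.memLp_of_hasCompactSupport hDcs)
    have hDle : ∫⁻ x, ‖D x‖ₑ ^ 2 ≤ ENNReal.ofReal (t ^ 2) ^ 2 * B := by
      have hind : ∀ x, ‖D x‖ₑ ^ 2 ≤ (Metric.closedBall (0 : V) (R + ‖v‖)).indicator
          (fun _ => ENNReal.ofReal (C * t ^ 2) ^ 2) x := by
        intro x
        by_cases hx : x ∈ Metric.closedBall (0 : V) (R + ‖v‖)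
        · rw [indicator_of_mem hx]
          gcongr
          rw [← ofReal_norm]
          exact ENNReal.ofReal_le_ofReal (hC t x)
        · rw [hDsupp x (by simpa using hx)]
          simp
      refine (lintegral_mono hind).trans ?_
      rw [lintegral_indicator_const measurableSet_closedBall, ENNReal.ofReal_mul' (sq_nonneg t),
        mul_pow, hB]
      exact le_of_eq (by ring)
    have hlow : ∫⁻ x in {x | |inner ℝ v x| ≤ N},
        ENNReal.ofReal (t ^ 2) ^ 2 * ‖((inner ℝ v x ^ 2 : ℝ) : ℂ) * 𝓕⁻ m x‖ₑ ^ 2 ≤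
        ∫⁻ x, ‖𝓕⁻ D x‖ₑ ^ 2 := by
      refine le_trans (setLIntegral_mono' ?_ fun x hx => ?_) (setLIntegral_le_lintegral _ _)
      · exact measurableSet_le (by fun_prop) measurable_const
      · rw [hD, fourierInv_second_difference hmi, ← mul_pow]
        gcongr
        rw [← ofReal_norm, ← ofReal_norm, ← ENNReal.ofReal_mul (sq_nonneg t)]
        refine ENNReal.ofReal_le_ofReal ?_
        rw [norm_mul, norm_mul, ← mul_assoc, Complex.norm_real, Complex.norm_real,
          Real.norm_of_nonneg (sq_nonneg _), real_inner_smul_left]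
        gcongr
        set y : ℝ := inner ℝ v x
        have hy : |y| ≤ N := hx
        have hty : |t * y| ≤ 1 / 2 := by
          rw [abs_mul, abs_of_pos ht0, ht]
          calc 1 / (2 * N) * |y| ≤ 1 / (2 * N) * N := by gcongr
            _ = 1 / 2 := by field_simp
        have hpi := Real.pi_pos
        have hcos := Real.cos_le_one_sub_mul_cos_sq (x := 2 * Real.pi * (t * y)) (by
          rw [abs_mul, abs_of_pos (by positivity : 0 < 2 * Real.pi)]
          nlinarith)
        have he : 2 / Real.pi ^ 2 * (2 * Real.pi * (t * y)) ^ 2 = 8 * (t ^ 2 * y ^ 2) := by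
          field_simp
          ring
        rw [he] at hcos
        refine le_trans ?_ (neg_le_abs _)
        nlinarith [mul_nonneg (sq_nonneg t) (sq_nonneg y)]
    have h := hlow.trans (hpl.le.trans hDle)
    rw [lintegral_const_mul' _ _ (by simp)] at h
    exact (ENNReal.mul_le_mul_iff_right (by positivity) (by simp)).1 h
  have hun : ⋃ n : ℕ, {x : V | |inner ℝ v x| ≤ (n + 1 : ℕ)} = univ := by
    refine eq_univ_of_forall fun x => mem_iUnion.2 ?_
    obtain ⟨n, hn⟩ := exists_nat_ge |inner ℝ v x|
    exact ⟨n, hn.trans (by push_cast; linarith)⟩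
  rw [← setLIntegral_univ, ← hun, setLIntegral_iUnion_of_directed]
  · exact (iSup_le key).trans_lt hBtop
  · refine Monotone.directed_le fun a b hab x hx => ?_
    have hx' : |inner ℝ v x| ≤ ((a + 1 : ℕ) : ℝ) := hx
    have hab' : ((a + 1 : ℕ) : ℝ) ≤ ((b + 1 : ℕ) : ℝ) := by exact_mod_cast Nat.succ_le_succ hab
    exact hx'.trans hab'

end FourierDecay

/-! ### The Riesz wavelets as functions -/

/-- Cauchy–Schwarz: the hypotheses put `(1 + ‖x‖²) g` in `L²`, and `(1 + ‖x‖)^H / (1 + ‖x‖²)` is in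
`L²` of the plane because `4 - 2H > 2`. -/
theorem integrable_one_add_norm_rpow_mul {g : Plane → ℂ} {H : ℝ} (hH : H < 1)
    (hg : AEStronglyMeasurable g volume) (h0 : MemLp g 2 volume)
    (h2 : ∀ j : Fin 2, MemLp (fun x : Plane => ((x j ^ 2 : ℝ) : ℂ) * g x) 2 volume) :
    Integrable fun x : Plane => (1 + ‖x‖) ^ H * ‖g x‖ := by
  have hA : MemLp (fun x : Plane => (1 + ‖x‖ ^ 2) * ‖g x‖) 2 volume := by
    have h3 : MemLp (fun x : Plane => g x + (((x 0 ^ 2 : ℝ) : ℂ) * g x +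
        ((x 1 ^ 2 : ℝ) : ℂ) * g x)) 2 volume := h0.add ((h2 0).add (h2 1))
    refine h3.norm.congr_norm (by fun_prop) (Filter.Eventually.of_forall fun x => ?_)
    have hn : ‖x‖ ^ 2 = x 0 ^ 2 + x 1 ^ 2 := by
      rw [EuclideanSpace.norm_sq_eq]; simp
    have e : g x + (((x 0 ^ 2 : ℝ) : ℂ) * g x + ((x 1 ^ 2 : ℝ) : ℂ) * g x) =
        ((1 + ‖x‖ ^ 2 : ℝ) : ℂ) * g x := by
      rw [hn]; push_cast; ring
    rw [e]
    simp only [norm_mul, Complex.norm_real, norm_norm]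
  have hw : Continuous fun x : Plane => (1 + ‖x‖) ^ H / (1 + ‖x‖ ^ 2) := by
    refine Continuous.div (Continuous.rpow_const (by fun_prop) fun x => Or.inl ?_) (by fun_prop)
      fun x => by positivity
    positivity
  have hB : MemLp (fun x : Plane => (1 + ‖x‖) ^ H / (1 + ‖x‖ ^ 2)) 2 volume := by
    rw [memLp_two_iff_integrable_sq hw.aestronglyMeasurable]
    have hi : Integrable (fun x : Plane => (1 + ‖x‖) ^ (-(4 - 2 * H))) volume :=
      integrable_one_add_norm (by simp; linarith)
    refine (hi.const_mul 4).mono' (hw.pow 2).aestronglyMeasurable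
      (Filter.Eventually.of_forall fun x => ?_)
    have h1 : 0 < 1 + ‖x‖ := by positivity
    rw [Real.norm_of_nonneg (sq_nonneg _), div_pow, div_le_iff₀ (by positivity),
      show -(4 - 2 * H) = H + H - (4 : ℕ) by push_cast; ring, Real.rpow_sub h1, Real.rpow_add h1,
      Real.rpow_natCast]
    have h4 : (1 + ‖x‖) ^ 4 ≤ 4 * (1 + ‖x‖ ^ 2) ^ 2 := by
      have : (1 + ‖x‖) ^ 2 ≤ 2 * (1 + ‖x‖ ^ 2) := by nlinarith [sq_nonneg (1 - ‖x‖)]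
      nlinarith [sq_nonneg (1 + ‖x‖)]
    have h5 : 0 ≤ (1 + ‖x‖) ^ H := by positivity
    rw [← mul_div_assoc, div_mul_eq_mul_div, le_div_iff₀ (by positivity)]
    nlinarith [mul_le_mul_of_nonneg_left h4 (mul_nonneg h5 h5)]
  refine (hB.integrable_mul hA).congr (Filter.Eventually.of_forall fun x => ?_)
  have : (1 + ‖x‖ ^ 2 : ℝ) ≠ 0 := by positivity
  simp only [Pi.mul_apply]
  field_simp

/-- The Fourier multiplier `(i η_ℓ / ‖η‖) φ(2π‖η‖)` of the Riesz wavelet. -/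
noncomputable def rieszMultiplier (φ : ℝ → ℝ) (l : Fin 2) (η : Plane) : ℂ :=
  rieszSymbol l η * ((φ (2 * Real.pi * ‖η‖) : ℝ) : ℂ)

/-- The continuous representative of the Riesz transform of the mother wavelet. -/
noncomputable def rieszKernel (φ : ℝ → ℝ) (l : Fin 2) : Plane → ℂ := 𝓕⁻ (rieszMultiplier φ l)

theorem rieszMultiplier_eq (φ : ℝ → ℝ) (l : Fin 2) (η : Plane) :
    rieszMultiplier φ l η =
      Complex.I * (directionalProfile (fun r => φ (2 * Real.pi * r)) l η : ℝ) := by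
  rw [rieszMultiplier, rieszSymbol, directionalProfile]
  push_cast
  ring

/-- The multiplier is `i` times a real odd function, so conjugation amounts to `η ↦ -η` and the
kernel is real. -/
theorem conj_rieszKernel (φ : ℝ → ℝ) (l : Fin 2) (x : Plane) :
    conj (rieszKernel φ l x) = rieszKernel φ l x := by
  rw [rieszKernel, Real.fourierInv_eq', ← integral_conj, ← integral_neg_eq_self]
  refine integral_congr_ae (Filter.Eventually.of_forall fun η => ?_)
  simp only [rieszMultiplier_eq, directionalProfile, smul_eq_mul, map_mul, ← Complex.exp_conj,
    Complex.conj_ofReal, Complex.conj_I, inner_neg_left, norm_neg, PiLp.neg_apply]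
  push_cast
  simp only [mul_neg, neg_mul, neg_neg]
  ring_nf

namespace IsRadialProfile

variable {N : ℕ} {φ : ℝ → ℝ} (hφ : IsRadialProfile N φ)

include hφ

/-- This value makes the multiplier continuous at the origin, bounds its second differences, and
tames the singularity of the radial integral. -/
theorem map_zero : φ 0 = 0 := by
  simpa using hφ.vanishing 0 (Nat.zero_le _)

theorem contDiffOn_comp_mul : ContDiffOn ℝ 2 (fun r => φ (2 * Real.pi * r)) (Ici 0) :=
  hφ.smooth.comp (by fun_prop) fun r hr => by
    have h : (0 : ℝ) ≤ r := hr
    exact mem_Ici.2 (by positivity)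

theorem comp_mul_eq_zero {r : ℝ} (hr : 1 / 2 < r) : φ (2 * Real.pi * r) = 0 :=
  hφ.support _ (by nlinarith [Real.pi_pos])

theorem continuous_rieszMultiplier (l : Fin 2) : Continuous (rieszMultiplier φ l) := by
  have h := continuous_directionalProfile hφ.contDiffOn_comp_mul.continuousOn
    (by simpa using hφ.map_zero) l
  rw [show rieszMultiplier φ l = _ from funext (rieszMultiplier_eq φ l)]
  fun_prop

theorem rieszMultiplier_eq_zero (l : Fin 2) (η : Plane) (hη : 1 / 2 < ‖η‖) :
    rieszMultiplier φ l η = 0 := by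
  rw [rieszMultiplier, hφ.comp_mul_eq_zero hη, Complex.ofReal_zero, mul_zero]

theorem hasCompactSupport_rieszMultiplier (l : Fin 2) :
    HasCompactSupport (rieszMultiplier φ l) :=
  HasCompactSupport.intro (isCompact_closedBall (0 : Plane) (1 / 2)) fun η hη =>
    hφ.rieszMultiplier_eq_zero l η (by simpa using hη)

theorem integrable_rieszMultiplier (l : Fin 2) : Integrable (rieszMultiplier φ l) :=
  (hφ.continuous_rieszMultiplier l).integrable_of_hasCompactSupport
    (hφ.hasCompactSupport_rieszMultiplier l)

theorem memLp_rieszMultiplier (l : Fin 2) : MemLp (rieszMultiplier φ l) 2 volume :=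
  (hφ.continuous_rieszMultiplier l).memLp_of_hasCompactSupport
    (hφ.hasCompactSupport_rieszMultiplier l)

theorem continuous_rieszKernel (l : Fin 2) : Continuous (rieszKernel φ l) :=
  continuous_fourierInv_of_integrable (hφ.integrable_rieszMultiplier l)

/-- Replaces the `L²` class in the definition of the wavelet by a continuous function given by an
honest Fourier integral. -/
theorem rieszTransform_ae_eq (l : Fin 2) :
    (rieszTransform l (motherWavelet hφ) : Plane → ℂ) =ᵐ[volume] rieszKernel φ l := by
  have h : rieszTransform l (motherWavelet hφ) = 𝓕⁻ ((hφ.memLp_rieszMultiplier l).toLp _) := by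
    unfold rieszTransform
    congr 1
    refine MemLp.toLp_congr _ _ ?_
    rw [motherWavelet, FourierTransform.fourier_fourierInv_eq]
    filter_upwards [hφ.memLp.coeFn_toLp] with η hη
    rw [hη, rieszMultiplier]
  rw [h]
  exact fourierInv_toLp_ae_eq (hφ.integrable_rieszMultiplier l) (hφ.memLp_rieszMultiplier l)

/-- Second differences of the multiplier along the two axes put `x_j²` times the kernel in `L²`;
this beats the growth `(1 + ‖x‖)^H` of the field. -/
theorem integrable_weight_mul_rieszKernel {H : ℝ} (hH : H < 1) (l : Fin 2) :
    Integrable fun x : Plane => (1 + ‖x‖) ^ H * ‖rieszKernel φ l x‖ := by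
  obtain ⟨C, -, hC⟩ := exists_second_difference_bound hφ.contDiffOn_comp_mul
    (by simpa using hφ.map_zero) (fun r hr => hφ.comp_mul_eq_zero hr) l
  have hk := hφ.continuous_rieszKernel l
  refine integrable_one_add_norm_rpow_mul hH hk.aestronglyMeasurable
    ((memLp_congr_ae (fourierInv_toLp_ae_eq (hφ.integrable_rieszMultiplier l)
      (hφ.memLp_rieszMultiplier l))).1 (Lp.memLp _)) fun j => ⟨by fun_prop, ?_⟩
  have h := lintegral_enorm_inner_sq_mul_fourierInv_lt_top (hφ.continuous_rieszMultiplier l)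
    (hφ.rieszMultiplier_eq_zero l) (EuclideanSpace.single j (1 : ℝ)) (C := C) fun t η => by
      have e : (t • EuclideanSpace.single j (1 : ℝ) : Plane) = EuclideanSpace.single j t := by
        ext a; simp
      rw [e]
      simp only [rieszMultiplier_eq]
      have := hC j t η
      rw [← Real.norm_eq_abs, ← Complex.norm_real, ← one_mul ‖_‖, ← Complex.norm_I,
        ← norm_mul] at this
      refine le_trans (le_of_eq ?_) this
      congr 1
      push_cast
      ring
  rw [← eLpNorm_two_sq] at h
  have hs : ∀ x : Plane, inner ℝ (EuclideanSpace.single j (1 : ℝ)) x = x j := fun x => by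
    simp [EuclideanSpace.inner_single_left]
  simp only [hs] at h
  simpa [rieszKernel] using h

theorem integrable_rieszKernel (l : Fin 2) : Integrable (rieszKernel φ l) := by
  have h := hφ.integrable_weight_mul_rieszKernel (H := 0) one_pos l
  simp only [Real.rpow_zero, one_mul] at h
  exact (integrable_norm_iff (hφ.continuous_rieszKernel l).aestronglyMeasurable).1 h

theorem fourier_rieszKernel (l : Fin 2) : 𝓕 (rieszKernel φ l) = rieszMultiplier φ l := by
  refine Continuous.fourier_fourierInv_eq (hφ.continuous_rieszMultiplier l)
    (hφ.integrable_rieszMultiplier l) ?_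
  have h := (hφ.integrable_rieszKernel l).comp_neg
  refine h.congr (Filter.Eventually.of_forall fun x => ?_)
  simp only [rieszKernel]
  rw [Real.fourierInv_eq_fourier_neg, neg_neg]

theorem integral_rieszKernel_mul_exp (l : Fin 2) (ζ : Plane) :
    ∫ x, rieszKernel φ l x * Complex.exp (Complex.I * (inner ℝ x ζ : ℝ)) =
      -(Complex.I * ((ζ l / ‖ζ‖ : ℝ) : ℂ)) * ((φ ‖ζ‖ : ℝ) : ℂ) := by
  have hpi := Real.pi_pos
  -- The character `e^{i⟨x,ζ⟩}` is the kernel of `𝓕` at frequency `-ζ / (2π)`; oddness of the Riesz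
  -- symbol produces the sign.
  have h := congrFun (hφ.fourier_rieszKernel l) (-((2 * Real.pi)⁻¹ • ζ))
  rw [Real.fourier_eq'] at h
  have hn : ‖-((2 * Real.pi)⁻¹ • ζ)‖ = (2 * Real.pi)⁻¹ * ‖ζ‖ := by
    rw [norm_neg, norm_smul, Real.norm_of_nonneg (by positivity)]
  have e : rieszMultiplier φ l (-((2 * Real.pi)⁻¹ • ζ)) =
      -(Complex.I * ((ζ l / ‖ζ‖ : ℝ) : ℂ)) * ((φ ‖ζ‖ : ℝ) : ℂ) := by
    rw [rieszMultiplier, rieszSymbol, hn, mul_inv_cancel_left₀ (by positivity)]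
    simp only [PiLp.neg_apply, PiLp.smul_apply, smul_eq_mul]
    rw [neg_div, mul_div_mul_left _ _ (by positivity)]
    push_cast
    ring
  rw [← e, ← h]
  refine integral_congr_ae (Filter.Eventually.of_forall fun x => ?_)
  simp only [inner_neg_right, real_inner_smul_right, smul_eq_mul]
  rw [mul_comm]
  congr 2
  push_cast
  field_simp

end IsRadialProfile

/-- The continuous representative of the Riesz wavelet. -/
noncomputable def waveletKernel (φ : ℝ → ℝ) (i : ℤ) (k : Fin 2 → ℤ) (l : Fin 2) (x : Plane) : ℂ :=
  (2 : ℂ) ^ i * rieszKernel φ l ((2 : ℝ) ^ i • x - WithLp.toLp 2 fun j => (k j : ℝ))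

theorem conj_waveletKernel (φ : ℝ → ℝ) (i : ℤ) (k : Fin 2 → ℤ) (l : Fin 2) (x : Plane) :
    conj (waveletKernel φ i k l x) = waveletKernel φ i k l x := by
  simp [waveletKernel, conj_rieszKernel, Complex.conj_ofNat]

/-- Change of variables `y = c x - v` in the plane. -/
theorem integral_comp_smul_sub {E : Type*} [NormedAddCommGroup E] [NormedSpace ℝ E]
    (u : Plane → E) {c : ℝ} (hc : 0 < c) (v : Plane) :
    ∫ x, u (c • x - v) = (c ^ 2)⁻¹ • ∫ y, u y := by
  rw [Measure.integral_comp_smul volume (fun y => u (y - v)), integral_sub_right_eq_self u v]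
  simp [abs_of_pos hc]

namespace IsRadialProfile

variable {N : ℕ} {φ : ℝ → ℝ} (hφ : IsRadialProfile N φ) (i : ℤ) (k : Fin 2 → ℤ) (l : Fin 2)

include hφ

theorem continuous_waveletKernel : Continuous (waveletKernel φ i k l) := by
  have := hφ.continuous_rieszKernel l
  unfold waveletKernel
  fun_prop

theorem rieszWavelet_ae_eq : rieszWavelet hφ i k l =ᵐ[volume] waveletKernel φ i k l := by
  set v : Plane := WithLp.toLp 2 fun j => (k j : ℝ) with hv
  have hc : (2 : ℝ) ^ i ≠ 0 := by positivity
  have hq : Measure.QuasiMeasurePreserving (fun x : Plane => (2 : ℝ) ^ i • x - v)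
      volume volume := by
    refine (measurePreserving_sub_right volume v).quasiMeasurePreserving.comp ?_
    refine ⟨by fun_prop, ?_⟩
    rw [Measure.map_addHaar_smul _ hc]
    exact Measure.smul_absolutelyContinuous
  filter_upwards [hq.ae_eq_comp (hφ.rieszTransform_ae_eq l)] with x hx
  simp only [Function.comp_apply] at hx
  rw [rieszWavelet, waveletKernel, ← hv, hx]

theorem integrable_weight_mul_waveletKernel {H : ℝ} (hH0 : 0 ≤ H) (hH : H < 1) :
    Integrable fun x : Plane => (1 + ‖x‖) ^ H * ‖waveletKernel φ i k l x‖ := by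
  set v : Plane := WithLp.toLp 2 fun j => (k j : ℝ) with hv
  set c : ℝ := (2 : ℝ) ^ i with hc
  have hc0 : 0 < c := by positivity
  have h1 : Integrable fun x : Plane =>
      (1 + ‖c • x - v‖) ^ H * ‖rieszKernel φ l (c • x - v)‖ :=
    ((hφ.integrable_weight_mul_rieszKernel hH l).comp_sub_right v).comp_smul hc0.ne'
  -- Chosen so that `1 + ‖x‖ ≤ A (1 + ‖c x - v‖)`, which compares the weights before and after the
  -- change of variables.
  set A : ℝ := 1 + c⁻¹ * (1 + ‖v‖) with hA
  have hA0 : 0 < A := by positivity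
  refine (h1.const_mul (A ^ H * c)).mono' ?_ (Filter.Eventually.of_forall fun x => ?_)
  · have := hφ.continuous_waveletKernel i k l
    refine Continuous.aestronglyMeasurable (Continuous.mul ?_ this.norm)
    exact Continuous.rpow_const (by fun_prop) fun x => Or.inr hH0
  · have hx : 1 + ‖x‖ ≤ A * (1 + ‖c • x - v‖) := by
      have h2 : ‖x‖ = c⁻¹ * ‖c • x‖ := by
        rw [norm_smul, Real.norm_of_nonneg hc0.le, inv_mul_cancel_left₀ hc0.ne']
      have h3 : ‖c • x‖ ≤ ‖c • x - v‖ + ‖v‖ := by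
        have := norm_add_le (c • x - v) v
        rwa [sub_add_cancel] at this
      have h4 : ‖x‖ ≤ c⁻¹ * (‖c • x - v‖ + ‖v‖) := by
        rw [h2]; gcongr
      have h5 : 0 < c⁻¹ := by positivity
      have h6 := mul_nonneg (mul_nonneg h5.le (norm_nonneg v)) (norm_nonneg (c • x - v))
      rw [hA]
      nlinarith [norm_nonneg (c • x - v)]
    have hn : ‖waveletKernel φ i k l x‖ = c * ‖rieszKernel φ l (c • x - v)‖ := by
      rw [waveletKernel, norm_mul, norm_zpow, Complex.norm_two]
    rw [norm_mul, norm_norm, Real.norm_of_nonneg (by positivity), hn]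
    calc (1 + ‖x‖) ^ H * (c * ‖rieszKernel φ l (c • x - v)‖)
        ≤ (A * (1 + ‖c • x - v‖)) ^ H * (c * ‖rieszKernel φ l (c • x - v)‖) := by
          gcongr
      _ = _ := by rw [Real.mul_rpow hA0.le (by positivity)]; ring

theorem integrable_waveletKernel : Integrable (waveletKernel φ i k l) := by
  have h := hφ.integrable_weight_mul_waveletKernel i k l (H := 0) le_rfl one_pos
  simp only [Real.rpow_zero, one_mul] at h
  exact (integrable_norm_iff (hφ.continuous_waveletKernel i k l).aestronglyMeasurable).1 h

theorem integral_waveletKernel_mul_exp (ξ : Plane) :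
    ∫ x, waveletKernel φ i k l x * Complex.exp (Complex.I * (inner ℝ x ξ : ℝ)) =
      ((2 : ℂ) ^ i)⁻¹ * Complex.exp (Complex.I *
        (inner ℝ (WithLp.toLp 2 fun j => (k j : ℝ) : Plane) (((2 : ℝ) ^ i)⁻¹ • ξ) : ℝ)) *
      (-(Complex.I * ((ξ l / ‖ξ‖ : ℝ) : ℂ)) * ((φ (((2 : ℝ) ^ i)⁻¹ * ‖ξ‖) : ℝ) : ℂ)) := by
  set v : Plane := WithLp.toLp 2 fun j => (k j : ℝ) with hv
  set c : ℝ := (2 : ℝ) ^ i with hc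
  have hc0 : 0 < c := by positivity
  have hcC : (2 : ℂ) ^ i = (c : ℂ) := by rw [hc]; push_cast; rfl
  set u : Plane → ℂ := fun y => rieszKernel φ l y *
    Complex.exp (Complex.I * (inner ℝ y (c⁻¹ • ξ) : ℝ))
  have e : ∀ x : Plane, waveletKernel φ i k l x * Complex.exp (Complex.I * (inner ℝ x ξ : ℝ)) =
      ((2 : ℂ) ^ i * Complex.exp (Complex.I * (inner ℝ v (c⁻¹ • ξ) : ℝ))) * u (c • x - v) := by
    intro x
    have e1 : inner ℝ x ξ = inner ℝ v (c⁻¹ • ξ) + inner ℝ (c • x - v) (c⁻¹ • ξ) := by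
      rw [← inner_add_left, add_sub_cancel, real_inner_smul_left, real_inner_smul_right,
        mul_inv_cancel_left₀ hc0.ne']
    rw [waveletKernel, ← hv, ← hc, e1]
    push_cast
    rw [mul_add, Complex.exp_add]
    ring
  simp only [e]
  rw [integral_const_mul, integral_comp_smul_sub u hc0 v, hφ.integral_rieszKernel_mul_exp]
  have hn : ‖c⁻¹ • ξ‖ = c⁻¹ * ‖ξ‖ := by
    rw [norm_smul, Real.norm_of_nonneg (by positivity)]
  rw [hn, PiLp.smul_apply, smul_eq_mul, mul_div_mul_left _ _ (by positivity : c⁻¹ ≠ 0), hcC,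
    Complex.real_smul]
  have : (c : ℂ) ≠ 0 := by exact_mod_cast hc0.ne'
  push_cast
  field_simp

/-- The transform `∫ w(x) (e^{i⟨x,ξ⟩} - 1) dx` of a Riesz wavelet `w`. -/
theorem integral_waveletKernel_mul_exp_sub_one (ξ : Plane) :
    ∫ x, waveletKernel φ i k l x * (Complex.exp (Complex.I * (inner ℝ x ξ : ℝ)) - 1) =
      ((2 : ℂ) ^ i)⁻¹ * Complex.exp (Complex.I *
        (inner ℝ (WithLp.toLp 2 fun j => (k j : ℝ) : Plane) (((2 : ℝ) ^ i)⁻¹ • ξ) : ℝ)) *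
      (-(Complex.I * ((ξ l / ‖ξ‖ : ℝ) : ℂ)) * ((φ (((2 : ℝ) ^ i)⁻¹ * ‖ξ‖) : ℝ) : ℂ)) := by
  have hi := hφ.integrable_waveletKernel i k l
  -- The transform at frequency `0` vanishes, so the term `-1` in the spectral kernel contributes
  -- nothing.
  have h0 : ∫ x, waveletKernel φ i k l x = 0 := by
    have := hφ.integral_waveletKernel_mul_exp i k l 0
    simpa [hφ.map_zero] using this
  have hie : Integrable fun x => waveletKernel φ i k l x *
      Complex.exp (Complex.I * (inner ℝ x ξ : ℝ)) := by
    have hc := hφ.continuous_waveletKernel i k l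
    refine hi.norm.mono' (Continuous.aestronglyMeasurable (by fun_prop))
      (Filter.Eventually.of_forall fun x => ?_)
    rw [norm_mul, mul_comm Complex.I, Complex.norm_exp_ofReal_mul_I, mul_one]
  simp only [mul_sub, mul_one]
  rw [integral_sub hie hi, h0, sub_zero, hφ.integral_waveletKernel_mul_exp]

/-- The wavelets are real, so the second factor is the conjugate of a transform of the same type.
The phases due to the translation `k` are then inverse to each other: the covariance does not see
`k`. -/
theorem integral_waveletKernel_mul_exp_mul_conj (a b : Fin 2) (ξ : Plane) :
    (∫ x, waveletKernel φ i k a x * (Complex.exp (Complex.I * (inner ℝ x ξ : ℝ)) - 1)) *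
      (∫ y, waveletKernel φ i k b y * (Complex.exp (-(Complex.I * (inner ℝ y ξ : ℝ))) - 1)) =
    ((((2 : ℝ) ^ i) ^ 2)⁻¹ * (ξ a / ‖ξ‖) * (ξ b / ‖ξ‖) * φ (((2 : ℝ) ^ i)⁻¹ * ‖ξ‖) ^ 2 : ℝ) := by
  have e : ∫ y, waveletKernel φ i k b y * (Complex.exp (-(Complex.I * (inner ℝ y ξ : ℝ))) - 1) =
      conj (∫ y, waveletKernel φ i k b y *
        (Complex.exp (Complex.I * (inner ℝ y ξ : ℝ)) - 1)) := by
    rw [← integral_conj]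
    refine integral_congr_ae (Filter.Eventually.of_forall fun y => ?_)
    simp [conj_waveletKernel, ← Complex.exp_conj]
  rw [e, hφ.integral_waveletKernel_mul_exp_sub_one, hφ.integral_waveletKernel_mul_exp_sub_one]
  set w : ℝ := inner ℝ (WithLp.toLp 2 fun j => (k j : ℝ) : Plane) (((2 : ℝ) ^ i)⁻¹ • ξ)
  simp only [map_mul, map_neg, map_inv₀, map_zpow₀, Complex.conj_I, Complex.conj_ofReal,
    ← Complex.exp_conj, Complex.conj_ofNat]
  have hE : Complex.exp (Complex.I * w) * Complex.exp (-Complex.I * w) = 1 := by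
    rw [← Complex.exp_add]; simp
  push_cast
  linear_combination (((2 : ℂ) ^ i) ^ 2)⁻¹ * (ξ a / ‖ξ‖) * (ξ b / ‖ξ‖) *
    φ (((2 : ℝ) ^ i)⁻¹ * ‖ξ‖) ^ 2 *
    (hE - Complex.exp (Complex.I * w) * Complex.exp (-Complex.I * w) * Complex.I_sq)

end IsRadialProfile

/-! ### The field as a curve in `L²(Ω; ℝ)` -/

section FieldCurve

variable {Ω : Type*} [MeasurableSpace Ω]

/-- The field `x ↦ X(x)` as a map with values in `L²(Ω; ℝ)`. -/
noncomputable def IsGaussianField.toRealL2 {X : Plane → Ω → ℝ} {P : Measure Ω}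
    (hX : IsGaussianField X P) (x : Plane) : Lp ℝ 2 P :=
  (hX.gaussian.hasGaussianLaw_eval x).memLp_two.toLp _

/-- The inclusion of `L²(Ω; ℝ)` into `L²(Ω; ℂ)`. -/
noncomputable def lpOfReal (P : Measure Ω) : Lp ℝ 2 P →L[ℝ] Lp ℂ 2 P :=
  Complex.ofRealCLM.compLpL 2 P

theorem coeFn_lpOfReal {P : Measure Ω} (Z : Lp ℝ 2 P) :
    lpOfReal P Z =ᵐ[P] fun ω => ((Z ω : ℝ) : ℂ) :=
  Complex.ofRealCLM.coeFn_compLpL Z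

theorem real_inner_eq_integral {P : Measure Ω} (Z W : Lp ℝ 2 P) :
    inner ℝ Z W = ∫ ω, Z ω * W ω ∂P := by
  rw [L2.inner_def]
  refine integral_congr_ae (Filter.Eventually.of_forall fun ω => ?_)
  simp [mul_comm]

theorem IsSelfSimilar.cov_smul {P : Measure Ω} {X : Plane → Ω → ℝ} {H : ℝ}
    (hself : IsSelfSimilar H X P) {c : ℝ} (hc : 0 < c) (x y : Plane) :
    ∫ ω, X (c • x) ω * X (c • y) ω ∂P =
      c ^ (2 * H) * ∫ ω, X x ω * X y ω ∂P := by
  classical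
  have h := hself c hc {x, y}
  have hx : x ∈ ({x, y} : Finset Plane) := by simp
  have hy : y ∈ ({x, y} : Finset Plane) := by simp
  have hm : Measurable fun v : ({x, y} : Finset Plane) → ℝ => v ⟨x, hx⟩ * v ⟨y, hy⟩ := by
    fun_prop
  have h2 := (h.comp hm).integral_eq
  simp only [Function.comp_def] at h2
  rw [h2, ← integral_const_mul]
  refine integral_congr_ae (Filter.Eventually.of_forall fun ω => ?_)
  simp only
  rw [two_mul, Real.rpow_add hc]
  ring

variable {P : Measure Ω} {X : Plane → Ω → ℝ} (hX : IsGaussianField X P)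

include hX

theorem IsGaussianField.coeFn_toRealL2 (x : Plane) : hX.toRealL2 x =ᵐ[P] X x :=
  MemLp.coeFn_toLp _

theorem IsGaussianField.lpOfReal_toRealL2 (x : Plane) :
    lpOfReal P (hX.toRealL2 x) = hX.toL2 x := by
  refine Lp.ext ?_
  filter_upwards [coeFn_lpOfReal (hX.toRealL2 x), hX.coeFn_toRealL2 x,
    (hX.memLp x).coeFn_toLp] with ω h1 h2 h3
  rw [h1, h2]
  exact h3.symm

theorem IsGaussianField.inner_toRealL2 (x y : Plane) :
    inner ℝ (hX.toRealL2 x) (hX.toRealL2 y) = ∫ ω, X x ω * X y ω ∂P := by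
  rw [real_inner_eq_integral]
  refine integral_congr_ae ?_
  filter_upwards [hX.coeFn_toRealL2 x, hX.coeFn_toRealL2 y] with ω h1 h2
  rw [h1, h2]

/-- With `K` the covariance function, `‖X(y) - X(x)‖² = K(y,y) - 2 K(y,x) + K(x,x)`, which is
continuous in `y` and vanishes at `y = x`. -/
theorem IsGaussianField.continuous_toRealL2 : Continuous hX.toRealL2 := by
  refine continuous_iff_continuousAt.2 fun x => tendsto_iff_norm_sub_tendsto_zero.2 ?_
  have hK := hX.continuous_cov
  have hk : Continuous fun y => √((∫ ω, X y ω * X y ω ∂P) - 2 * (∫ ω, X y ω * X x ω ∂P) +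
      ∫ ω, X x ω * X x ω ∂P) := by
    have h1 : Continuous fun y => ∫ ω, X y ω * X y ω ∂P :=
      hK.comp (continuous_id.prodMk continuous_id)
    have h2 : Continuous fun y => ∫ ω, X y ω * X x ω ∂P :=
      hK.comp (continuous_id.prodMk continuous_const)
    fun_prop
  have h := hk.tendsto x
  rw [show (∫ ω, X x ω * X x ω ∂P) - 2 * (∫ ω, X x ω * X x ω ∂P) +
    ∫ ω, X x ω * X x ω ∂P = 0 by ring, Real.sqrt_zero] at h
  refine h.congr fun y => ?_
  rw [← hX.inner_toRealL2, ← hX.inner_toRealL2, ← hX.inner_toRealL2,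
    real_inner_self_eq_norm_sq, real_inner_self_eq_norm_sq, ← norm_sub_sq_real,
    Real.sqrt_sq (norm_nonneg _)]

/-- Compactness bounds the field on the unit ball; outside, self-similarity gives `‖X(x)‖ = ‖x‖^H
‖X(x/‖x‖)‖`. -/
theorem IsGaussianField.exists_norm_toRealL2_le {H : ℝ} (hH : 0 < H)
    (hself : IsSelfSimilar H X P) :
    ∃ C, 0 < C ∧ ∀ x, ‖hX.toRealL2 x‖ ≤ C * (1 + ‖x‖) ^ H := by
  obtain ⟨M, hM⟩ := (isCompact_closedBall (0 : Plane) 1).exists_bound_of_continuousOn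
    hX.continuous_toRealL2.continuousOn
  have hM0 : 0 ≤ M := (norm_nonneg _).trans (hM 0 (by simp))
  refine ⟨M + 1, by linarith, fun x => ?_⟩
  have h1 : 1 ≤ (1 + ‖x‖) ^ H := Real.one_le_rpow (by linarith [norm_nonneg x]) hH.le
  rcases le_or_gt ‖x‖ 1 with hx | hx
  · have := hM x (by simpa using hx)
    nlinarith
  · have hx0 : 0 < ‖x‖ := by linarith
    set u : Plane := ‖x‖⁻¹ • x with hu
    have hun : ‖u‖ = 1 := by
      rw [hu, norm_smul, norm_inv, norm_norm, inv_mul_cancel₀ hx0.ne']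
    have hxu : x = ‖x‖ • u := by rw [hu, smul_inv_smul₀ hx0.ne']
    have h2 : ‖hX.toRealL2 x‖ ^ 2 = (‖x‖ ^ H * ‖hX.toRealL2 u‖) ^ 2 := by
      rw [← real_inner_self_eq_norm_sq, hX.inner_toRealL2]
      nth_rewrite 1 [hxu]
      nth_rewrite 2 [hxu]
      rw [hself.cov_smul hx0, ← hX.inner_toRealL2, real_inner_self_eq_norm_sq, mul_pow,
        two_mul, Real.rpow_add hx0]
      ring
    have h3 : ‖hX.toRealL2 x‖ = ‖x‖ ^ H * ‖hX.toRealL2 u‖ :=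
      (pow_left_inj₀ (norm_nonneg _) (by positivity) two_ne_zero).1 h2
    rw [h3, mul_comm]
    have h4 := hM u (by simp [hun])
    gcongr
    · linarith
    · linarith

theorem IsGaussianField.integrable_smul_toRealL2 {H : ℝ} (hH : 0 < H)
    (hself : IsSelfSimilar H X P) {w : Plane → ℝ} (hw : Continuous w)
    (hwi : Integrable fun x => (1 + ‖x‖) ^ H * ‖w x‖) :
    Integrable fun x => w x • hX.toRealL2 x := by
  obtain ⟨C, -, hC⟩ := hX.exists_norm_toRealL2_le hH hself
  refine (hwi.const_mul C).mono' (hw.smul hX.continuous_toRealL2).aestronglyMeasurable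
    (Filter.Eventually.of_forall fun x => ?_)
  rw [norm_smul]
  calc ‖w x‖ * ‖hX.toRealL2 x‖ ≤ ‖w x‖ * (C * (1 + ‖x‖) ^ H) := by gcongr; exact hC x
    _ = _ := by ring

theorem IsGaussianField.inner_integral_smul_toRealL2 {v w : Plane → ℝ}
    (hv : Integrable fun x => v x • hX.toRealL2 x) (hw : Integrable fun x => w x • hX.toRealL2 x) :
    inner ℝ (∫ x, v x • hX.toRealL2 x) (∫ y, w y • hX.toRealL2 y) =
      ∫ x, ∫ y, v x * w y * ∫ ω, X x ω * X y ω ∂P := by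
  rw [real_inner_comm, ← integral_inner hv]
  refine integral_congr_ae (Filter.Eventually.of_forall fun x => ?_)
  simp only
  rw [real_inner_comm, ← integral_inner hw]
  refine integral_congr_ae (Filter.Eventually.of_forall fun y => ?_)
  simp only
  rw [real_inner_smul_left, real_inner_smul_right, hX.inner_toRealL2, mul_assoc]

/-! ### The Gaussian space of the field -/

/-- The Gaussian space of the field, i.e. the closed span of the field in `L²(Ω; ℝ)`. -/
noncomputable def IsGaussianField.gaussianSpace : Submodule ℝ (Lp ℝ 2 P) :=
  (Submodule.span ℝ (range hX.toRealL2)).topologicalClosure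

/-- The closed span is the double orthogonal complement of the span, and inner products pass under
the Bochner integral. -/
theorem IsGaussianField.integral_mem_gaussianSpace {w : Plane → ℝ}
    (hw : Integrable fun x => w x • hX.toRealL2 x) :
    ∫ x, w x • hX.toRealL2 x ∈ hX.gaussianSpace := by
  rw [IsGaussianField.gaussianSpace, ← Submodule.orthogonal_orthogonal_eq_closure,
    Submodule.mem_orthogonal]
  intro u hu
  rw [← integral_inner hw]
  refine integral_eq_zero_of_ae (Filter.Eventually.of_forall fun x => ?_)
  simp only [Pi.zero_apply]
  rw [real_inner_smul_right, real_inner_comm, (Submodule.mem_orthogonal _ _).1 hu _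
    (Submodule.subset_span (mem_range_self x)), mul_zero]

omit hX in
theorem integral_abs_sub_le_norm [IsProbabilityMeasure P] (Z W : Lp ℝ 2 P) :
    ∫ ω, |Z ω - W ω| ∂P ≤ ‖Z - W‖ := by
  have h1 : ∫ ω, |Z ω - W ω| ∂P = (eLpNorm (Z - W : Lp ℝ 2 P) 1 P).toReal := by
    rw [eLpNorm_one_eq_lintegral_enorm, ← integral_norm_eq_lintegral_enorm
      (Lp.aestronglyMeasurable _)]
    refine integral_congr_ae ?_
    filter_upwards [Lp.coeFn_sub Z W] with ω h
    rw [h]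
    rfl
  rw [h1, Lp.norm_def]
  exact ENNReal.toReal_mono (Lp.eLpNorm_ne_top _)
    (eLpNorm_le_eLpNorm_of_exponent_le (by norm_num) (Lp.aestronglyMeasurable _))

-- Applied to the identity and to `r ↦ e^{ir}`, this makes the mean and the characteristic function
-- at `1` continuous on `L²(Ω)`.
omit hX in
theorem continuous_integral_comp_of_lipschitz [IsProbabilityMeasure P] {E : Type*}
    [NormedAddCommGroup E] [NormedSpace ℝ E] {u : ℝ → E} (hu : LipschitzWith 1 u) :
    Continuous fun Z : Lp ℝ 2 P => ∫ ω, u (Z ω) ∂P := by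
  have hint : ∀ Z : Lp ℝ 2 P, Integrable (fun ω => u (Z ω)) P := fun Z => by
    have hZ : Integrable (fun ω => Z ω) P := (Lp.memLp Z).integrable (by norm_num)
    refine ((integrable_const ‖u 0‖).add hZ.norm).mono'
      (hu.continuous.comp_aestronglyMeasurable hZ.1) (Filter.Eventually.of_forall fun ω => ?_)
    have h := hu.dist_le_mul (Z ω) 0
    simp only [NNReal.coe_one, one_mul, dist_eq_norm, sub_zero] at h
    calc ‖u (Z ω)‖ = ‖u 0 + (u (Z ω) - u 0)‖ := by rw [add_sub_cancel]
      _ ≤ _ := (norm_add_le _ _).trans (by simpa using h)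
  refine (LipschitzWith.of_dist_le_mul (K := 1) fun Z W => ?_).continuous
  rw [dist_eq_norm, dist_eq_norm, NNReal.coe_one, one_mul, ← integral_sub (hint Z) (hint W)]
  refine (norm_integral_le_integral_norm _).trans (le_trans ?_ (integral_abs_sub_le_norm Z W))
  have hZW : Integrable (fun ω => |Z ω - W ω|) P :=
    (((Lp.memLp Z).integrable (by norm_num)).sub ((Lp.memLp W).integrable (by norm_num))).abs
  refine integral_mono ((hint Z).sub (hint W)).norm hZW fun ω => ?_
  have h := hu.dist_le_mul (Z ω) (W ω)
  simpa [dist_eq_norm] using h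

omit hX in
theorem lipschitzWith_cexp_mul_I :
    LipschitzWith 1 fun r : ℝ => Complex.exp ((r : ℂ) * Complex.I) := by
  refine LipschitzWith.of_dist_le_mul fun r s => ?_
  rw [NNReal.coe_one, one_mul, dist_eq_norm, Real.dist_eq]
  have h : Complex.exp ((r : ℂ) * Complex.I) - Complex.exp ((s : ℂ) * Complex.I) =
      Complex.exp ((s : ℂ) * Complex.I) *
        (Complex.exp (Complex.I * ((r - s : ℝ) : ℂ)) - 1) := by
    rw [mul_sub, ← Complex.exp_add, mul_one]
    congr 2
    push_cast
    ring
  rw [h, norm_mul, Complex.norm_exp_ofReal_mul_I, one_mul]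
  exact Real.norm_exp_I_mul_ofReal_sub_one_le

/-- The elements of the Gaussian space of a field are centered Gaussian variables. -/
theorem IsGaussianField.charFun_of_mem_gaussianSpace [IsProbabilityMeasure P] {Z : Lp ℝ 2 P}
    (hZ : Z ∈ hX.gaussianSpace) :
    ∫ ω, Z ω ∂P = 0 ∧ ∫ ω, Complex.exp ((Z ω : ℂ) * Complex.I) ∂P =
      Complex.exp (-((‖Z‖ ^ 2 / 2 : ℝ) : ℂ)) := by
  -- Both identities are closed conditions in `L²`, so they need only be checked on finite linear
  -- combinations of the field.
  set A : Set (Lp ℝ 2 P) := {Z | ∫ ω, Z ω ∂P = 0 ∧ ∫ ω, Complex.exp ((Z ω : ℂ) * Complex.I) ∂P =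
      Complex.exp (-((‖Z‖ ^ 2 / 2 : ℝ) : ℂ))} with hA
  have hAc : IsClosed A := by
    refine IsClosed.inter (isClosed_eq (continuous_integral_comp_of_lipschitz LipschitzWith.id)
      continuous_const) (isClosed_eq
        (continuous_integral_comp_of_lipschitz lipschitzWith_cexp_mul_I) (by fun_prop))
  refine closure_minimal (fun W hW => ?_) hAc hZ
  obtain ⟨c, rfl⟩ := (Finsupp.mem_span_range_iff_exists_finsupp).1 hW
  set W : Lp ℝ 2 P := c.sum fun x a => a • hX.toRealL2 x with hWd
  have hWe : W =ᵐ[P] fun ω => ∑ x ∈ c.support, c x • X x ω := by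
    have h1 : W = ∑ x ∈ c.support, c x • hX.toRealL2 x := rfl
    rw [h1]
    refine (Lp.coeFn_finsetSum _ _).trans ?_
    have h2 : ∀ x ∈ c.support, ((c x • hX.toRealL2 x : Lp ℝ 2 P) : Ω → ℝ) =ᵐ[P]
        fun ω => c x • X x ω := fun x _ => by
      filter_upwards [Lp.coeFn_smul (c x) (hX.toRealL2 x), hX.coeFn_toRealL2 x] with ω a1 a2
      rw [a1, Pi.smul_apply, a2]
    filter_upwards [(Filter.eventually_all_finset c.support).2 h2] with ω hω
    rw [Finset.sum_apply]
    exact Finset.sum_congr rfl hω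
  have hG : HasGaussianLaw (fun ω => ∑ x ∈ c.support, c x • X x ω) P :=
    (hX.gaussian.smul c).hasGaussianLaw_fun_sum
  have hG' : HasGaussianLaw (fun ω => W ω) P := hG.congr hWe.symm
  have hm : ∫ ω, W ω ∂P = 0 := by
    rw [integral_congr_ae hWe, integral_finsetSum (f := fun x ω => c x • X x ω) _
      fun x _ => ((hX.gaussian.hasGaussianLaw_eval x).integrable.smul (c x))]
    refine Finset.sum_eq_zero fun x _ => ?_
    rw [integral_smul, hX.centered, smul_zero]
  refine ⟨hm, ?_⟩
  have hv : Var[fun ω => W ω; P] = ‖W‖ ^ 2 := by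
    rw [variance_of_integral_eq_zero hG'.aemeasurable hm, ← real_inner_self_eq_norm_sq,
      real_inner_eq_integral]
    refine integral_congr_ae (Filter.Eventually.of_forall fun ω => ?_)
    simp [sq]
  have h := hG'.charFun_map_eq (1 : ℝ)
  rw [charFun_apply_real, integral_map hG'.aemeasurable
    (Continuous.aestronglyMeasurable (by fun_prop))] at h
  simp only [Complex.ofReal_one, one_mul, RCLike.inner_apply, conj_trivial, mul_one] at h
  rw [hm, hv] at h
  rw [h]
  push_cast
  congr 1
  ring

/-- Finite families in the Gaussian space of a field are jointly Gaussian. -/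
theorem IsGaussianField.hasGaussianLaw_of_mem_gaussianSpace [IsProbabilityMeasure P]
    {ι : Type*} [Fintype ι] {Z : ι → Lp ℝ 2 P} (hZ : ∀ l, Z l ∈ hX.gaussianSpace) :
    HasGaussianLaw (fun ω l => Z l ω) P := by
  classical
  have hmeas : AEMeasurable (fun ω l => Z l ω) P :=
    aemeasurable_pi_lambda _ fun l => (Lp.aestronglyMeasurable (Z l)).aemeasurable
  refine (hasGaussianLaw_iff_charFunDual_map_eq hmeas).2 fun L => ?_
  -- A linear functional of the vector again lies in the Gaussian space, so the characteristic
  -- function at `1` of each element determines the joint law.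
  set W : Lp ℝ 2 P := ∑ l, L (Pi.single l 1) • Z l with hW
  have hWm : W ∈ hX.gaussianSpace :=
    Submodule.sum_mem _ fun l _ => Submodule.smul_mem _ _ (hZ l)
  have hWe : W =ᵐ[P] fun ω => L fun l => Z l ω := by
    rw [hW]
    refine (Lp.coeFn_finsetSum _ _).trans ?_
    have h2 : ∀ l, ((L (Pi.single l 1) • Z l : Lp ℝ 2 P) : Ω → ℝ) =ᵐ[P]
        fun ω => L (Pi.single l 1) * Z l ω := fun l => Lp.coeFn_smul _ _
    filter_upwards [Filter.eventually_all.2 h2] with ω hω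
    rw [Finset.sum_apply]
    have h3 : (fun l => Z l ω) = ∑ l, Z l ω • (Pi.single l 1 : ι → ℝ) := by
      ext j
      simp [Finset.sum_apply, Pi.single_apply]
    rw [h3, map_sum]
    refine Finset.sum_congr rfl fun l _ => ?_
    rw [hω, map_smul, smul_eq_mul, mul_comm]
  obtain ⟨hm, hc⟩ := hX.charFun_of_mem_gaussianSpace hWm
  have hm' : ∫ ω, L (fun l => Z l ω) ∂P = 0 := by rw [← integral_congr_ae hWe, hm]
  have hv : Var[L ∘ fun ω l => Z l ω; P] = ‖W‖ ^ 2 := by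
    rw [← variance_congr (X := fun ω => W ω) (Y := L ∘ fun ω l => Z l ω) hWe,
      variance_of_integral_eq_zero (Lp.aestronglyMeasurable W).aemeasurable hm,
      ← real_inner_self_eq_norm_sq, real_inner_eq_integral]
    refine integral_congr_ae (Filter.Eventually.of_forall fun ω => ?_)
    simp [sq]
  rw [hv, charFunDual_apply, integral_map hmeas (Continuous.aestronglyMeasurable (by fun_prop))]
  have hc' : ∫ ω, Complex.exp ((L fun l => Z l ω : ℝ) * Complex.I) ∂P =
      Complex.exp (-((‖W‖ ^ 2 / 2 : ℝ) : ℂ)) := by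
    rw [← hc]
    refine integral_congr_ae ?_
    filter_upwards [hWe] with ω hω
    rw [hω]
  rw [hc']
  simp only [Function.comp_apply, hm']
  push_cast
  congr 1
  ring

end FieldCurve

/-! ### The spectral kernel -/

/-- The function `e^{i⟨x,ξ⟩} - 1`. -/
noncomputable def expSubOne (x ξ : Plane) : ℂ := Complex.exp (Complex.I * (inner ℝ x ξ : ℝ)) - 1

theorem conj_expSubOne (x ξ : Plane) :
    conj (expSubOne x ξ) = Complex.exp (-(Complex.I * (inner ℝ x ξ : ℝ))) - 1 := by
  simp [expSubOne, ← Complex.exp_conj]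

theorem continuous_expSubOne : Continuous fun p : Plane × Plane => expSubOne p.1 p.2 := by
  unfold expSubOne
  fun_prop

theorem continuous_expSubOne_right (x : Plane) : Continuous (expSubOne x) :=
  continuous_expSubOne.comp (continuous_const.prodMk continuous_id)

theorem expSubOne_mul_conj_self (x ξ : Plane) :
    expSubOne x ξ * conj (expSubOne x ξ) = ((‖expSubOne x ξ‖ ^ 2 : ℝ) : ℂ) := by
  rw [Complex.mul_conj, Complex.normSq_eq_norm_sq]

/-- Combines `|e^{is} - 1| ≤ 2` with `|e^{is} - 1| ≤ |s|`, to match the integrability condition on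
spectral measures. -/
theorem norm_expSubOne_sq_le (x ξ : Plane) :
    ‖expSubOne x ξ‖ ^ 2 ≤ (4 + ‖x‖ ^ 2) * min 1 (‖ξ‖ ^ 2) := by
  have h1 : ‖expSubOne x ξ‖ ≤ 2 := by
    refine (norm_sub_le _ _).trans ?_
    rw [mul_comm, Complex.norm_exp_ofReal_mul_I, norm_one]
    norm_num
  have h2 : ‖expSubOne x ξ‖ ≤ ‖x‖ * ‖ξ‖ :=
    Real.norm_exp_I_mul_ofReal_sub_one_le.trans (abs_real_inner_le_norm x ξ)
  have h0 := norm_nonneg (expSubOne x ξ)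
  rcases min_cases 1 (‖ξ‖ ^ 2) with ⟨h, -⟩ | ⟨h, -⟩ <;> rw [h]
  · nlinarith [sq_nonneg ‖x‖]
  · have := pow_le_pow_left₀ h0 h2 2
    nlinarith [sq_nonneg ‖ξ‖]

section SpectralMeasure

variable {σ : Measure Plane} (hσ : ∫⁻ ξ, ENNReal.ofReal (min 1 (‖ξ‖ ^ 2)) ∂σ < ⊤)

include hσ

theorem integrable_norm_expSubOne_sq (x : Plane) :
    Integrable (fun ξ => ‖expSubOne x ξ‖ ^ 2) σ := by
  have h1 : Integrable (fun ξ : Plane => min 1 (‖ξ‖ ^ 2)) σ := by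
    refine ⟨Continuous.aestronglyMeasurable (by fun_prop), ?_⟩
    rwa [hasFiniteIntegral_iff_ofReal (Filter.Eventually.of_forall fun ξ => by positivity)]
  refine (h1.const_mul (4 + ‖x‖ ^ 2)).mono'
    ((continuous_expSubOne_right x).norm.pow 2).aestronglyMeasurable
    (Filter.Eventually.of_forall fun ξ => ?_)
  rw [Real.norm_of_nonneg (sq_nonneg _)]
  exact norm_expSubOne_sq_le x ξ

theorem integrable_expSubOne_mul_conj (x y : Plane) :
    Integrable (fun ξ => expSubOne x ξ * conj (expSubOne y ξ)) σ := by
  refine ((integrable_norm_expSubOne_sq hσ x).add (integrable_norm_expSubOne_sq hσ y)).mono'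
    (Continuous.aestronglyMeasurable ((continuous_expSubOne_right x).mul
      (Complex.continuous_conj.comp (continuous_expSubOne_right y))))
    (Filter.Eventually.of_forall fun ξ => ?_)
  rw [norm_mul, RCLike.norm_conj, Pi.add_apply]
  nlinarith [sq_nonneg (‖expSubOne x ξ‖ - ‖expSubOne y ξ‖), norm_nonneg (expSubOne x ξ),
    norm_nonneg (expSubOne y ξ)]

theorem isFiniteMeasure_withDensity_expSubOne (x : Plane) :
    IsFiniteMeasure (σ.withDensity fun ξ => ENNReal.ofReal (‖expSubOne x ξ‖ ^ 2)) :=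
  isFiniteMeasure_withDensity_ofReal (integrable_norm_expSubOne_sq hσ x).2

/-- Writing `E_x = e^{i⟨x,ξ⟩} - 1`, one has `e^{i⟨z,ξ⟩} E_x = E_{x+z} - E_z`. For a spectral measure
the right-hand side is a difference of covariances, which is what makes the spectral density unique.
-/
theorem charFun_withDensity_expSubOne (x z : Plane) :
    charFun (σ.withDensity fun ξ => ENNReal.ofReal (‖expSubOne x ξ‖ ^ 2)) z =
      ∫ ξ, expSubOne (x + z) ξ * conj (expSubOne x ξ) ∂σ -
        ∫ ξ, expSubOne z ξ * conj (expSubOne x ξ) ∂σ := by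
  have hm : Measurable fun ξ : Plane => ENNReal.ofReal (‖expSubOne x ξ‖ ^ 2) :=
    ((continuous_expSubOne_right x).norm.pow 2).measurable.ennreal_ofReal
  rw [charFun_apply, integral_withDensity_eq_integral_toReal_smul hm
    (Filter.Eventually.of_forall fun _ => ENNReal.ofReal_lt_top),
    ← integral_sub (integrable_expSubOne_mul_conj hσ _ _) (integrable_expSubOne_mul_conj hσ _ _)]
  refine integral_congr_ae (Filter.Eventually.of_forall fun ξ => ?_)
  simp only
  rw [ENNReal.toReal_ofReal (sq_nonneg _), Complex.real_smul, ← expSubOne_mul_conj_self, ← sub_mul,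
    mul_right_comm]
  congr 1
  simp only [expSubOne, inner_add_left, Complex.ofReal_add, mul_add, Complex.exp_add,
    real_inner_comm z ξ, mul_comm _ Complex.I]
  ring

end SpectralMeasure

/-- Countably many `x` suffice to separate every `ξ ≠ 0`, so that only countably many null sets are
discarded. The point `π ξ / ‖ξ‖²` gives the value `-2`, and the condition is open in `x`. -/
theorem exists_expSubOne_ne_zero {ξ : Plane} (hξ : ξ ≠ 0) :
    ∃ n, expSubOne (TopologicalSpace.denseSeq Plane n) ξ ≠ 0 := by
  have ho : IsOpen {x : Plane | expSubOne x ξ ≠ 0} :=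
    isOpen_ne_fun (continuous_expSubOne.comp (continuous_id.prodMk continuous_const))
      continuous_const
  have hne : {x : Plane | expSubOne x ξ ≠ 0}.Nonempty := by
    refine ⟨(Real.pi * (‖ξ‖ ^ 2)⁻¹) • ξ, ?_⟩
    have : ‖ξ‖ ≠ 0 := norm_ne_zero_iff.2 hξ
    have h : inner ℝ ((Real.pi * (‖ξ‖ ^ 2)⁻¹) • ξ) ξ = Real.pi := by
      rw [real_inner_smul_left, real_inner_self_eq_norm_sq]
      field_simp
    rw [mem_ofPred_eq, expSubOne, h, mul_comm, Complex.exp_pi_mul_I]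
    norm_num
  exact (TopologicalSpace.denseRange_denseSeq Plane).exists_mem_open ho hne

/-! ### Uniqueness and homogeneity of the spectral density -/

namespace IsSpectralMeasure

variable {Ω : Type*} [MeasurableSpace Ω] {P : Measure Ω} {X : Plane → Ω → ℝ}

theorem covariance_eq {σ : Measure Plane} (hσ : IsSpectralMeasure X P σ) (x y : Plane) :
    ((∫ ω, X x ω * X y ω ∂P : ℝ) : ℂ) = ∫ ξ, expSubOne x ξ * conj (expSubOne y ξ) ∂σ := by
  simp only [conj_expSubOne]
  exact hσ.covariance x y

end IsSpectralMeasure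

/-- The spectral density of a field is unique. -/
theorem IsSpectralDensity.ae_eq {Ω : Type*} [MeasurableSpace Ω] {P : Measure Ω}
    {X : Plane → Ω → ℝ} {f g : Plane → ℝ} (hf : IsSpectralDensity X P f)
    (hg : IsSpectralDensity X P g) : f =ᵐ[volume] g := by
  have hm : ∀ x, Measurable fun ξ : Plane => ENNReal.ofReal (‖expSubOne x ξ‖ ^ 2) := fun x =>
    ((continuous_expSubOne_right x).norm.pow 2).measurable.ennreal_ofReal
  have key : ∀ x, ∀ᵐ ξ : Plane, ENNReal.ofReal (f ξ) * ENNReal.ofReal (‖expSubOne x ξ‖ ^ 2) =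
      ENNReal.ofReal (g ξ) * ENNReal.ofReal (‖expSubOne x ξ‖ ^ 2) := by
    intro x
    have i1 := isFiniteMeasure_withDensity_expSubOne hf.spectral.finite x
    have i2 := isFiniteMeasure_withDensity_expSubOne hg.spectral.finite x
    -- The two finite measures have the same characteristic function, both being expressed by the
    -- covariance of `X`.
    have h : (volume.withDensity fun ξ => ENNReal.ofReal (f ξ)).withDensity
          (fun ξ => ENNReal.ofReal (‖expSubOne x ξ‖ ^ 2)) =
        (volume.withDensity fun ξ => ENNReal.ofReal (g ξ)).withDensity
          (fun ξ => ENNReal.ofReal (‖expSubOne x ξ‖ ^ 2)) := by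
      refine Measure.ext_of_charFun (funext fun z => ?_)
      rw [charFun_withDensity_expSubOne hf.spectral.finite,
        charFun_withDensity_expSubOne hg.spectral.finite,
        ← hf.spectral.covariance_eq, ← hf.spectral.covariance_eq,
        ← hg.spectral.covariance_eq, ← hg.spectral.covariance_eq]
    rw [← withDensity_mul _ hf.measurable.ennreal_ofReal (hm x),
      ← withDensity_mul _ hg.measurable.ennreal_ofReal (hm x),
      withDensity_eq_iff_of_sigmaFinite
        (hf.measurable.ennreal_ofReal.mul (hm x)).aemeasurable
        (hg.measurable.ennreal_ofReal.mul (hm x)).aemeasurable] at h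
    exact h
  have h0 : ∀ᵐ ξ : Plane, ξ ≠ 0 := by simp [ae_iff]
  filter_upwards [ae_all_iff.2 fun n => key (TopologicalSpace.denseSeq Plane n), h0] with ξ h1 h2
  obtain ⟨n, hn⟩ := exists_expSubOne_ne_zero h2
  have h3 := (ENNReal.mul_left_inj (by
    have := norm_pos_iff.2 hn
    simp only [ne_eq, ENNReal.ofReal_eq_zero, not_le]
    positivity) ENNReal.ofReal_ne_top).1 (h1 n)
  exact (ENNReal.ofReal_eq_ofReal_iff (hf.nonneg ξ) (hg.nonneg ξ)).1 h3

/-- The spectral measure with density `f` is finite against `min(1,‖ξ‖²)`. -/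
theorem lintegral_withDensity_min_lt_top_iff {f : Plane → ℝ} (hf : Measurable f)
    (h0 : ∀ ξ, 0 ≤ f ξ) :
    ∫⁻ ξ, ENNReal.ofReal (min 1 (‖ξ‖ ^ 2)) ∂(volume.withDensity fun ξ => ENNReal.ofReal (f ξ)) < ⊤
      ↔ Integrable fun ξ : Plane => f ξ * min 1 (‖ξ‖ ^ 2) := by
  rw [lintegral_withDensity_eq_lintegral_mul _ hf.ennreal_ofReal (by fun_prop)]
  have h1 : ∀ ξ : Plane, 0 ≤ f ξ * min 1 (‖ξ‖ ^ 2) := fun ξ => mul_nonneg (h0 ξ) (by positivity)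
  have h2 : AEStronglyMeasurable (fun ξ : Plane => f ξ * min 1 (‖ξ‖ ^ 2)) volume :=
    Measurable.aestronglyMeasurable (by fun_prop)
  rw [Integrable, and_iff_right h2, hasFiniteIntegral_iff_ofReal (Filter.Eventually.of_forall h1)]
  simp only [Pi.mul_apply, ENNReal.ofReal_mul (h0 _)]

theorem integral_withDensity_ofReal {E : Type*} [NormedAddCommGroup E] [NormedSpace ℝ E]
    {f : Plane → ℝ} (hf : Measurable f) (h0 : ∀ ξ, 0 ≤ f ξ) (u : Plane → E) :
    ∫ ξ, u ξ ∂(volume.withDensity fun ξ => ENNReal.ofReal (f ξ)) = ∫ ξ, f ξ • u ξ := by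
  rw [integral_withDensity_eq_integral_toReal_smul hf.ennreal_ofReal
    (Filter.Eventually.of_forall fun _ => ENNReal.ofReal_lt_top)]
  simp only [ENNReal.toReal_ofReal (h0 _)]

/-- Self-similarity rescales the spectral density. -/
theorem IsSpectralDensity.rescale {Ω : Type*} [MeasurableSpace Ω] {P : Measure Ω} {H : ℝ}
    {X : Plane → Ω → ℝ} {f : Plane → ℝ} (hf : IsSpectralDensity X P f)
    (hself : IsSelfSimilar H X P) {c : ℝ} (hc : 0 < c) :
    IsSpectralDensity X P fun ξ => c ^ (2 * H + 2) * f (c • ξ) := by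
  have hm : Measurable fun ξ : Plane => c ^ (2 * H + 2) * f (c • ξ) :=
    (hf.measurable.comp (measurable_const_smul c)).const_mul _
  have h0 : ∀ ξ : Plane, 0 ≤ c ^ (2 * H + 2) * f (c • ξ) := fun ξ =>
    mul_nonneg (by positivity) (hf.nonneg _)
  refine ⟨hm, h0, ?_, fun x y => ?_⟩
  · rw [lintegral_withDensity_min_lt_top_iff hm h0]
    have h1 := (lintegral_withDensity_min_lt_top_iff hf.measurable hf.nonneg).1 hf.spectral.finite
    refine ((h1.comp_smul hc.ne').const_mul (c ^ (2 * H + 2) * (1 + (c ^ 2)⁻¹))).mono'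
      (Measurable.aestronglyMeasurable (by fun_prop)) (Filter.Eventually.of_forall fun ξ => ?_)
    rw [Real.norm_of_nonneg (mul_nonneg (h0 ξ) (by positivity))]
    -- A dilation changes `min(1, ‖ξ‖²)` by a bounded factor only.
    have h2 : min 1 (‖ξ‖ ^ 2) ≤ (1 + (c ^ 2)⁻¹) * min 1 (‖c • ξ‖ ^ 2) := by
      rw [norm_smul, Real.norm_of_nonneg hc.le, mul_pow]
      have hc2 : 0 < (c ^ 2)⁻¹ := by positivity
      rcases min_cases 1 (c ^ 2 * ‖ξ‖ ^ 2) with ⟨h, -⟩ | ⟨h, -⟩ <;> rw [h]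
      · exact (min_le_left _ _).trans (by linarith)
      · refine (min_le_right _ _).trans ?_
        have h3 : (c ^ 2)⁻¹ * (c ^ 2 * ‖ξ‖ ^ 2) = ‖ξ‖ ^ 2 := by field_simp
        rw [add_mul, h3]
        nlinarith [mul_nonneg (sq_nonneg c) (sq_nonneg ‖ξ‖)]
    calc c ^ (2 * H + 2) * f (c • ξ) * min 1 (‖ξ‖ ^ 2)
        ≤ c ^ (2 * H + 2) * f (c • ξ) * ((1 + (c ^ 2)⁻¹) * min 1 (‖c • ξ‖ ^ 2)) := by
          gcongr
          exact h0 ξ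
      _ = _ := by ring
  · rw [integral_withDensity_ofReal hm h0]
    -- The substitution `ξ ↦ c ξ` in the covariance at `(x/c, y/c)` costs `c^{-2}` and
    -- self-similarity costs `c^{-2H}`; the prefactor `c^{2H+2}` compensates both.
    have h1 := hf.spectral.covariance (c⁻¹ • x) (c⁻¹ • y)
    rw [integral_withDensity_ofReal hf.measurable hf.nonneg] at h1
    have h2 := Measure.integral_comp_smul (volume : Measure Plane) (fun ξ => f ξ •
      ((Complex.exp (Complex.I * (inner ℝ (c⁻¹ • x) ξ : ℝ)) - 1) *
      (Complex.exp (-(Complex.I * (inner ℝ (c⁻¹ • y) ξ : ℝ))) - 1))) c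
    rw [← h1, hself.cov_smul (inv_pos.2 hc)] at h2
    simp only [real_inner_smul_left, real_inner_smul_right, mul_inv_cancel_left₀ hc.ne'] at h2
    simp only [mul_smul]
    rw [integral_smul, h2]
    simp only [finrank_euclideanSpace_fin, Complex.real_smul]
    rw [← Complex.ofReal_mul, ← Complex.ofReal_mul]
    congr 1
    rw [abs_of_pos (by positivity), Real.rpow_add hc, Real.inv_rpow hc.le, Real.rpow_two]
    have : c ^ (2 * H) ≠ 0 := by positivity
    field_simp

/-- Spectral densities of self-similar fields have an anisotropy function. -/
theorem IsSpectralDensity.exists_isAnisotropyFunction {Ω : Type*} [MeasurableSpace Ω]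
    {P : Measure Ω} {H : ℝ} {X : Plane → Ω → ℝ} {f : Plane → ℝ} (hf : IsSpectralDensity X P f)
    (hself : IsSelfSimilar H X P) : ∃ S : Circle1 → ℝ, IsAnisotropyFunction H f S := by
  have hfm := hf.measurable
  set G : Plane → ℝ := fun ξ => ‖ξ‖ ^ (2 * H + 2) * f ξ with hG
  have hGm : Measurable G := by fun_prop
  -- Uniqueness gives invariance of `G` for each `c`, with a null set depending on `c`; Fubini below
  -- exchanges the two quantifiers.
  have h1 : ∀ᵐ c : ℝ, ∀ᵐ ξ : Plane, 0 < c → G (c • ξ) = G ξ := by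
    refine Filter.Eventually.of_forall fun c => ?_
    by_cases hc : 0 < c
    · filter_upwards [hf.ae_eq (hf.rescale hself hc)] with ξ hξ _
      rw [hG]
      simp only
      rw [hξ, norm_smul, Real.norm_of_nonneg hc.le, Real.mul_rpow hc.le (norm_nonneg _)]
      ring
    · exact Filter.Eventually.of_forall fun ξ h => absurd h hc
  have hms : MeasurableSet {p : ℝ × Plane | 0 < p.1 → G (p.1 • p.2) = G p.2} := by
    have e : {p : ℝ × Plane | 0 < p.1 → G (p.1 • p.2) = G p.2} =
        {p | 0 < p.1}ᶜ ∪ {p | G (p.1 • p.2) = G p.2} := by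
      ext p; simp only [mem_ofPred_eq, mem_union, mem_compl_iff]; tauto
    rw [e]
    exact (measurableSet_lt measurable_const measurable_fst).compl.union
      (measurableSet_eq_fun (by fun_prop) (by fun_prop))
  rw [Measure.ae_ae_comm hms] at h1
  have h0 : ∀ᵐ ξ : Plane, ξ ≠ 0 := by simp [ae_iff]
  -- The choice `c = s / ‖ξ‖` moves `ξ` to the circle of radius `s`.
  have h2 : ∀ᵐ ξ : Plane, ∀ᵐ s : ℝ, 0 < s → G ((s * ‖ξ‖⁻¹) • ξ) = G ξ := by
    filter_upwards [h1, h0] with ξ hξ hne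
    have hn : 0 < ‖ξ‖⁻¹ := inv_pos.2 (norm_pos_iff.2 hne)
    have hq : Measure.QuasiMeasurePreserving (fun s : ℝ => s * ‖ξ‖⁻¹) volume volume := by
      refine ⟨by fun_prop, ?_⟩
      rw [Real.map_volume_mul_right hn.ne']
      exact Measure.smul_absolutelyContinuous
    filter_upwards [hq.ae hξ] with s hs hs0
    exact hs (by positivity)
  have hms2 : MeasurableSet {p : Plane × ℝ | 0 < p.2 → G ((p.2 * ‖p.1‖⁻¹) • p.1) = G p.1} := by
    have e : {p : Plane × ℝ | 0 < p.2 → G ((p.2 * ‖p.1‖⁻¹) • p.1) = G p.1} =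
        {p | 0 < p.2}ᶜ ∪ {p | G ((p.2 * ‖p.1‖⁻¹) • p.1) = G p.1} := by
      ext p; simp only [mem_ofPred_eq, mem_union, mem_compl_iff]; tauto
    rw [e]
    exact (measurableSet_lt measurable_const measurable_snd).compl.union
      (measurableSet_eq_fun (by fun_prop) (by fun_prop))
  rw [Measure.ae_ae_comm (p := fun (ξ : Plane) (s : ℝ) => 0 < s → G ((s * ‖ξ‖⁻¹) • ξ) = G ξ)
    hms2] at h2
  -- After a second exchange a single radius `s` works for almost every `ξ`, and `Θ ↦ G (s Θ)` is
  -- the anisotropy function.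
  obtain ⟨s, hs0, hs⟩ : ∃ s : ℝ, 0 < s ∧ ∀ᵐ ξ : Plane, 0 < s → G ((s * ‖ξ‖⁻¹) • ξ) = G ξ := by
    have hne : (volume.restrict (Ioi (0 : ℝ))) ≠ 0 := by simp
    have : (ae (volume.restrict (Ioi (0 : ℝ)))).NeBot := ae_neBot.2 hne
    exact ((ae_restrict_mem measurableSet_Ioi).and (ae_restrict_of_ae h2)).exists
  refine ⟨fun Θ => G (s • (Θ : Plane)), by fun_prop, fun Θ => ?_, ?_⟩
  · exact mul_nonneg (by positivity) (hf.nonneg _)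
  · filter_upwards [hs, h0] with ξ hξ hne Θ hΘ
    have hn : 0 < ‖ξ‖ := norm_pos_iff.2 hne
    have e : (s * ‖ξ‖⁻¹) • ξ = s • (Θ : Plane) := by
      nth_rewrite 2 [hΘ]
      rw [smul_smul, mul_assoc, inv_mul_cancel₀ hn.ne', mul_one]
    rw [← e, hξ hs0, hG]
    simp only
    rw [← mul_assoc, ← Real.rpow_add hn, show -2 * H - 2 + (2 * H + 2) = 0 by ring,
      Real.rpow_zero, one_mul]

/-! ### Polar coordinates in the plane -/

/-- Polar coordinates `(Θ, r) ↦ r Θ`. -/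
def polarMap (z : Circle1 × Ioi (0 : ℝ)) : Plane := (z.2 : ℝ) • (z.1 : Plane)

theorem norm_polarMap (z : Circle1 × Ioi (0 : ℝ)) : ‖polarMap z‖ = z.2 := by
  have h1 : ‖(z.1 : Plane)‖ = 1 := by simp
  have h2 : (0 : ℝ) < z.2 := z.2.2
  rw [polarMap, norm_smul, h1, mul_one, Real.norm_of_nonneg h2.le]

theorem polarMap_eq : polarMap = Subtype.val ∘ (homeomorphUnitSphereProd Plane).symm := by
  ext1 z
  obtain ⟨y, rfl⟩ := (homeomorphUnitSphereProd Plane).surjective z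
  have hy : (y : Plane) ≠ 0 := y.2
  simp [polarMap, smul_smul, norm_ne_zero_iff.2 hy]

theorem measurableEmbedding_polarMap : MeasurableEmbedding polarMap := by
  rw [polarMap_eq]
  exact (MeasurableEmbedding.subtype_coe (measurableSet_singleton _).compl).comp
    (Homeomorph.measurableEmbedding _)

theorem measurePreserving_polarMap :
    MeasurePreserving polarMap (arcLength.prod (Measure.volumeIoiPow 1)) volume := by
  have h1 := (volume : Measure Plane).measurePreserving_homeomorphUnitSphereProd
  rw [finrank_euclideanSpace_fin] at h1
  have h2 : MeasurePreserving (homeomorphUnitSphereProd Plane).symm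
      (arcLength.prod (Measure.volumeIoiPow 1))
      ((volume : Measure Plane).comap (Subtype.val : ({0}ᶜ : Set Plane) → Plane)) :=
    MeasurePreserving.symm (homeomorphUnitSphereProd Plane).toMeasurableEquiv h1
  have h3 : MeasurePreserving (Subtype.val : ({0}ᶜ : Set Plane) → Plane)
      ((volume : Measure Plane).comap Subtype.val) volume := by
    have h := measurePreserving_subtype_coe (μa := (volume : Measure Plane))
      (measurableSet_singleton (0 : Plane)).compl
    rwa [restrict_compl_singleton] at h
  rw [polarMap_eq]
  exact h3.comp h2

theorem integral_volumeIoiPow_one (B : ℝ → ℝ) :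
    ∫ r : Ioi (0 : ℝ), B r ∂(Measure.volumeIoiPow 1) = ∫ r in Ioi (0 : ℝ), r * B r := by
  rw [Measure.volumeIoiPow, integral_withDensity_eq_integral_toReal_smul (by fun_prop)
    (Filter.Eventually.of_forall fun _ => ENNReal.ofReal_lt_top),
    ← integral_subtype_comap measurableSet_Ioi fun r => r * B r]
  refine integral_congr_ae (Filter.Eventually.of_forall fun r => ?_)
  have hr : (0 : ℝ) < r := r.2
  simp only [pow_one, smul_eq_mul]
  rw [ENNReal.toReal_ofReal hr.le]

section Polar

variable {u : Plane → ℝ} {A : Circle1 → ℝ} {B : ℝ → ℝ}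
  (hu : ∀ᵐ ξ : Plane, ∀ Θ : Circle1, ξ = ‖ξ‖ • (Θ : Plane) → u ξ = A Θ * B ‖ξ‖)

include hu

theorem ae_comp_polarMap_eq : ∀ᵐ z ∂(arcLength.prod (Measure.volumeIoiPow 1)),
    u (polarMap z) = A z.1 * B z.2 := by
  filter_upwards [measurePreserving_polarMap.quasiMeasurePreserving.ae hu] with z hz
  rw [hz z.1 (by rw [norm_polarMap]; rfl), norm_polarMap]

theorem integral_polar : ∫ ξ, u ξ = (∫ Θ, A Θ ∂arcLength) * ∫ r in Ioi (0 : ℝ), r * B r := by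
  rw [← measurePreserving_polarMap.integral_comp measurableEmbedding_polarMap,
    integral_congr_ae (ae_comp_polarMap_eq hu),
    integral_prod_mul (L := ℝ) A (fun r : Ioi (0 : ℝ) => B r), integral_volumeIoiPow_one]

/-- By Fubini `A * B r` is integrable on the circle for almost every `r`. The radial measure is
nonzero, so such an `r` exists, and `B r ≠ 0` can be divided out. -/
theorem integrable_of_integrable_polar (hB : ∀ r, 0 < r → B r ≠ 0) (hi : Integrable u) :
    Integrable A arcLength := by
  have h1 := (measurePreserving_polarMap.integrable_comp_emb measurableEmbedding_polarMap).2 hi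
  have h2 : Integrable (fun z : Circle1 × Ioi (0 : ℝ) => A z.1 * B z.2)
      (arcLength.prod (Measure.volumeIoiPow 1)) := h1.congr (ae_comp_polarMap_eq hu)
  have hne : (Measure.volumeIoiPow 1) ≠ 0 := by
    intro h
    have := Measure.volumeIoiPow_apply_Iio 1 ⟨1, mem_Ioi.2 one_pos⟩
    rw [h] at this
    norm_num at this
  have : (ae (Measure.volumeIoiPow 1)).NeBot := ae_neBot.2 hne
  obtain ⟨r, hr⟩ := h2.prod_left_ae.exists
  exact (integrable_mul_const_iff (hB r r.2).isUnit A).1 hr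

end Polar

/-! ### The anisotropy function and the structure tensor -/

theorem IsAnisotropyFunction.integrable {H : ℝ} {f : Plane → ℝ} {S : Circle1 → ℝ}
    (hS : IsAnisotropyFunction H f S)
    (hf : Integrable fun ξ : Plane => f ξ * min 1 (‖ξ‖ ^ 2)) : Integrable S arcLength := by
  refine integrable_of_integrable_polar (B := fun r => r ^ (-2 * H - 2) * min 1 (r ^ 2)) ?_
    (fun r hr => by positivity) hf
  filter_upwards [hS.eq] with ξ hξ Θ hΘ
  rw [hξ Θ hΘ]
  ring

theorem abs_circle_apply_le_one (Θ : Circle1) (a : Fin 2) : |(Θ : Plane) a| ≤ 1 := by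
  have h1 : ‖(Θ : Plane)‖ = 1 := by simp
  exact (PiLp.norm_apply_le (Θ : Plane) a).trans_eq h1

theorem integrable_structureTensor {S : Circle1 → ℝ} (hS : Integrable S arcLength) (a b : Fin 2) :
    Integrable (fun Θ : Circle1 => (Θ : Plane) a * (Θ : Plane) b * S Θ) arcLength := by
  refine hS.norm.mono' ((Measurable.aestronglyMeasurable (by fun_prop)).mul hS.1)
    (Filter.Eventually.of_forall fun Θ => ?_)
  rw [norm_mul]
  refine mul_le_of_le_one_left (norm_nonneg _) ?_
  rw [norm_mul]
  exact mul_le_one₀ (abs_circle_apply_le_one Θ a) (norm_nonneg _) (abs_circle_apply_le_one Θ b)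

theorem posSemidef_structureTensor {S : Circle1 → ℝ} (hS : Integrable S arcLength)
    (h0 : ∀ Θ, 0 ≤ S Θ) : (structureTensor S).PosSemidef := by
  refine Matrix.PosSemidef.of_dotProduct_mulVec_nonneg ?_ fun x => ?_
  · ext a b
    simp only [Matrix.conjTranspose_apply, structureTensor, Matrix.of_apply, star_trivial]
    simp only [mul_comm ((_ : Plane) b)]
  · have h := fun a b => integrable_structureTensor hS a b
    -- The quadratic form is the integral of `⟨x, Θ⟩² S(Θ)`.
    have e : star x ⬝ᵥ (structureTensor S).mulVec x =
        ∫ Θ : Circle1, (x 0 * (Θ : Plane) 0 + x 1 * (Θ : Plane) 1) ^ 2 * S Θ ∂arcLength := by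
      have e2 : ∀ Θ : Circle1, (x 0 * (Θ : Plane) 0 + x 1 * (Θ : Plane) 1) ^ 2 * S Θ =
          ∑ a, ∑ b, x a * ((Θ : Plane) a * (Θ : Plane) b * S Θ * x b) := fun Θ => by
        simp only [Fin.sum_univ_two]
        ring
      simp only [e2]
      rw [integral_finsetSum _ fun a _ => integrable_finsetSum _ fun b _ =>
        ((h a b).mul_const _).const_mul _]
      refine Finset.sum_congr rfl fun a _ => ?_
      rw [integral_finsetSum _ fun b _ => ((h a b).mul_const _).const_mul _, Matrix.mulVec,
        dotProduct, Finset.mul_sum]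
      refine Finset.sum_congr rfl fun b _ => ?_
      rw [integral_const_mul, integral_mul_const]
      rfl
    rw [e]
    exact integral_nonneg fun Θ => mul_nonneg (sq_nonneg _) (h0 Θ)

/-! ### The radial integral -/

namespace IsRadialProfile

variable {N : ℕ} {φ : ℝ → ℝ} (hφ : IsRadialProfile N φ)

include hφ

/-- Near `0` the bound `|φ r| ≤ C r` leaves `r^{1-2H}`, integrable since `H < 1`; beyond `π` the
profile vanishes. -/
theorem integrableOn_sq_div_rpow {H : ℝ} (hH1 : H < 1) :
    IntegrableOn (fun r : ℝ => |φ r| ^ 2 / r ^ (2 * H + 1)) (Ioi 0) volume := by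
  obtain ⟨_, _, C, hC, h⟩ := exists_deriv_bounds hφ.smooth hφ.map_zero hφ.support
  have hpi := Real.pi_pos
  have hc : ContinuousOn (fun r : ℝ => |φ r| ^ 2 / r ^ (2 * H + 1)) (Ioi 0) := by
    refine ContinuousOn.div ((hφ.smooth.continuousOn.mono Ioi_subset_Ici_self).abs.pow 2)
      (fun r hr => ?_) fun r hr => ?_
    · exact (Real.continuousAt_rpow_const r _ (Or.inl (ne_of_gt hr))).continuousWithinAt
    · have : (0 : ℝ) < r := hr
      positivity
  have h1 : IntegrableOn (fun r : ℝ => |φ r| ^ 2 / r ^ (2 * H + 1)) (Ioc 0 Real.pi) volume := by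
    have h2 : IntegrableOn (fun r : ℝ => C ^ 2 * r ^ (1 - 2 * H)) (Ioc 0 Real.pi) volume := by
      refine Integrable.const_mul ?_ _
      exact ((intervalIntegral.intervalIntegrable_rpow' (by linarith)).1)
    refine h2.mono' ((hc.mono Ioc_subset_Ioi_self).aestronglyMeasurable measurableSet_Ioc) ?_
    filter_upwards [ae_restrict_mem measurableSet_Ioc] with r hr
    have hr0 : 0 < r := hr.1
    rw [Real.norm_of_nonneg (by positivity), div_le_iff₀ (by positivity), mul_assoc,
      ← Real.rpow_add hr0, show 1 - 2 * H + (2 * H + 1) = (2 : ℕ) by push_cast; ring,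
      Real.rpow_natCast, ← mul_pow]
    exact pow_le_pow_left₀ (abs_nonneg _) (h r hr0).2.2.1 2
  have h3 : IntegrableOn (fun r : ℝ => |φ r| ^ 2 / r ^ (2 * H + 1)) (Ioi Real.pi) volume := by
    refine (integrableOn_zero : IntegrableOn (fun _ => (0 : ℝ)) (Ioi Real.pi) volume).congr_fun (fun r hr => ?_) measurableSet_Ioi
    simp [hφ.support r hr]
  rw [← Ioc_union_Ioi_eq_Ioi hpi.le]
  exact h1.union h3

/-- The partition identity at `r = 1` forces `φ(2^j) ≠ 0` for some `j`; by continuity `φ` is nonzero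
on an open set. -/
theorem integral_sq_div_rpow_pos {H : ℝ} (hH1 : H < 1) :
    0 < ∫ r in Ioi (0 : ℝ), |φ r| ^ 2 / r ^ (2 * H + 1) := by
  have hnn : ∀ r ∈ Ioi (0 : ℝ), 0 ≤ |φ r| ^ 2 / r ^ (2 * H + 1) := fun r hr => by
    have : (0 : ℝ) < r := hr
    positivity
  rw [setIntegral_pos_iff_support_of_nonneg_ae
    ((ae_restrict_iff' measurableSet_Ioi).2 (Filter.Eventually.of_forall hnn))
    (hφ.integrableOn_sq_div_rpow hH1)]
  obtain ⟨j, hj⟩ : ∃ j : ℤ, φ ((2 : ℝ) ^ j * 1) ≠ 0 := by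
    by_contra! hcon
    have h := hφ.partition 1 one_pos
    simp only [hcon] at h
    norm_num at h
    exact zero_ne_one (hasSum_zero.unique h)
  set s : ℝ := (2 : ℝ) ^ j * 1
  have hs : 0 < s := by positivity
  have hopen : IsOpen (Ioi (0 : ℝ) ∩ φ ⁻¹' {0}ᶜ) :=
    (hφ.smooth.continuousOn.mono Ioi_subset_Ici_self).isOpen_inter_preimage isOpen_Ioi
      isOpen_compl_singleton
  refine (hopen.measure_pos volume ⟨s, hs, hj⟩).trans_le (measure_mono fun r hr => ⟨?_, hr.1⟩)
  have h1 : (0 : ℝ) < r := hr.1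
  have h2 : φ r ≠ 0 := hr.2
  have h3 : 0 < |φ r| := abs_pos.2 h2
  exact (by positivity : |φ r| ^ 2 / r ^ (2 * H + 1) ≠ 0)

omit hφ in
theorem _root_.integral_sq_comp_mul_div_rpow (φ : ℝ → ℝ) {c : ℝ} (hc : 0 < c) (H : ℝ) :
    ∫ r in Ioi (0 : ℝ), |φ (c * r)| ^ 2 / r ^ (2 * H + 1) =
      c ^ (2 * H) * ∫ r in Ioi (0 : ℝ), |φ r| ^ 2 / r ^ (2 * H + 1) := by
  have h := integral_comp_mul_left_Ioi (fun r => |φ r| ^ 2 / r ^ (2 * H + 1)) 0 hc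
  rw [mul_zero, smul_eq_mul] at h
  have e : ∀ r ∈ Ioi (0 : ℝ), |φ (c * r)| ^ 2 / r ^ (2 * H + 1) =
      c ^ (2 * H + 1) * (|φ (c * r)| ^ 2 / (c * r) ^ (2 * H + 1)) := fun r hr => by
    have hr0 : (0 : ℝ) < r := hr
    rw [Real.mul_rpow hc.le hr0.le]
    have h1 : c ^ (2 * H + 1) ≠ 0 := by positivity
    have h2 : r ^ (2 * H + 1) ≠ 0 := by positivity
    field_simp
  rw [setIntegral_congr_fun measurableSet_Ioi e, integral_const_mul, h, Real.rpow_add hc,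
    Real.rpow_one]
  field_simp

end IsRadialProfile

/-! ### The covariance of linear functionals of the field -/

section Covariance

variable {Ω : Type*} [MeasurableSpace Ω] {P : Measure Ω} {X : Plane → Ω → ℝ} {σ : Measure Plane}

theorem IsSpectralMeasure.integral_norm_expSubOne_sq (hσ : IsSpectralMeasure X P σ)
    (hX : IsGaussianField X P) (x : Plane) :
    ∫ ξ, ‖expSubOne x ξ‖ ^ 2 ∂σ = ‖hX.toRealL2 x‖ ^ 2 := by
  have h := hσ.covariance_eq x x
  simp only [expSubOne_mul_conj_self] at h
  rw [integral_complex_ofReal] at h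
  rw [← real_inner_self_eq_norm_sq, hX.inner_toRealL2]
  exact_mod_cast h.symm

/-- Cauchy–Schwarz through the weighted inequality between means. Positive upper bounds `s`, `t`
replace the norms, which may vanish. -/
theorem IsSpectralMeasure.integral_norm_expSubOne_mul_le (hσ : IsSpectralMeasure X P σ)
    (hX : IsGaussianField X P) {x y : Plane} {s t : ℝ} (hs : 0 < s) (ht : 0 < t)
    (hxs : ‖hX.toRealL2 x‖ ≤ s) (hyt : ‖hX.toRealL2 y‖ ≤ t) :
    ∫ ξ, ‖expSubOne x ξ * conj (expSubOne y ξ)‖ ∂σ ≤ s * t := by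
  have hx := (integrable_norm_expSubOne_sq hσ.finite x).const_mul (t / (2 * s))
  have hy := (integrable_norm_expSubOne_sq hσ.finite y).const_mul (s / (2 * t))
  have h : ∀ ξ, ‖expSubOne x ξ * conj (expSubOne y ξ)‖ ≤
      t / (2 * s) * ‖expSubOne x ξ‖ ^ 2 + s / (2 * t) * ‖expSubOne y ξ‖ ^ 2 := by
    intro ξ
    rw [norm_mul, RCLike.norm_conj]
    set p := ‖expSubOne x ξ‖
    set q := ‖expSubOne y ξ‖
    have e : t / (2 * s) * p ^ 2 + s / (2 * t) * q ^ 2 - p * q =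
        (t * p - s * q) ^ 2 / (2 * s * t) := by
      field_simp
      ring
    have : 0 ≤ (t * p - s * q) ^ 2 / (2 * s * t) := by positivity
    linarith
  refine (integral_mono (integrable_expSubOne_mul_conj hσ.finite x y).norm (hx.add hy) h).trans ?_
  simp only [Pi.add_apply]
  rw [integral_add hx hy, integral_const_mul, integral_const_mul,
    hσ.integral_norm_expSubOne_sq hX, hσ.integral_norm_expSubOne_sq hX]
  calc t / (2 * s) * ‖hX.toRealL2 x‖ ^ 2 + s / (2 * t) * ‖hX.toRealL2 y‖ ^ 2
      ≤ t / (2 * s) * s ^ 2 + s / (2 * t) * t ^ 2 := by gcongr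
    _ = s * t := by field_simp; ring

/-- The covariance of linear functionals of the field in the spectral domain. -/
theorem IsSpectralMeasure.integral_integral_mul_cov [SFinite σ] (hσ : IsSpectralMeasure X P σ)
    (hX : IsGaussianField X P) {H : ℝ} (hH : 0 < H) (hself : IsSelfSimilar H X P)
    {v w : Plane → ℝ} (hv : Continuous v) (hw : Continuous w)
    (hvi : Integrable fun x => (1 + ‖x‖) ^ H * ‖v x‖)
    (hwi : Integrable fun x => (1 + ‖x‖) ^ H * ‖w x‖) :
    ((∫ x, ∫ y, v x * w y * ∫ ω, X x ω * X y ω ∂P : ℝ) : ℂ) =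
      ∫ ξ, (∫ x, (v x : ℂ) * expSubOne x ξ) * (∫ y, (w y : ℂ) * conj (expSubOne y ξ)) ∂σ := by
  obtain ⟨C, hC, hle⟩ := hX.exists_norm_toRealL2_le hH hself
  set F : Plane × Plane → Plane → ℂ := fun p ξ =>
    ((v p.1 * w p.2 : ℝ) : ℂ) * (expSubOne p.1 ξ * conj (expSubOne p.2 ξ)) with hF
  have hFc : Continuous (Function.uncurry F) := by
    simp only [Function.uncurry_def, hF, expSubOne]
    fun_prop
  have hFm : AEStronglyMeasurable (Function.uncurry F)
      (((volume : Measure Plane).prod volume).prod σ) := hFc.aestronglyMeasurable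
  -- This licenses Fubini: integrating `‖F‖` over `σ` leaves at most `C²` times the product of the
  -- two weighted functions.
  have hFi : Integrable (Function.uncurry F) (((volume : Measure Plane).prod volume).prod σ) := by
    refine (integrable_prod_iff hFm).2 ⟨Filter.Eventually.of_forall fun p =>
      (integrable_expSubOne_mul_conj hσ.finite p.1 p.2).const_mul ((v p.1 * w p.2 : ℝ) : ℂ), ?_⟩
    refine ((hvi.mul_prod hwi).const_mul (C ^ 2)).mono' hFm.norm.integral_prod_right'
      (Filter.Eventually.of_forall fun p => ?_)
    rw [Real.norm_of_nonneg (integral_nonneg fun ξ => norm_nonneg _)]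
    have e : ∀ ξ, ‖Function.uncurry F (p, ξ)‖ =
        ‖v p.1‖ * ‖w p.2‖ * ‖expSubOne p.1 ξ * conj (expSubOne p.2 ξ)‖ := fun ξ => by
      rw [Function.uncurry_apply_pair, hF]
      simp only
      rw [norm_mul, Complex.norm_real, norm_mul]
    simp only [e]
    rw [integral_const_mul]
    calc ‖v p.1‖ * ‖w p.2‖ * ∫ ξ, ‖expSubOne p.1 ξ * conj (expSubOne p.2 ξ)‖ ∂σ
        ≤ ‖v p.1‖ * ‖w p.2‖ * ((C * (1 + ‖p.1‖) ^ H) * (C * (1 + ‖p.2‖) ^ H)) := by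
          gcongr
          exact hσ.integral_norm_expSubOne_mul_le hX (by positivity) (by positivity)
            (hle p.1) (hle p.2)
      _ = _ := by ring
  have h1 : ((∫ x, ∫ y, v x * w y * ∫ ω, X x ω * X y ω ∂P : ℝ) : ℂ) =
      ∫ x, ∫ y, ∫ ξ, F (x, y) ξ ∂σ := by
    rw [← integral_complex_ofReal]
    refine integral_congr_ae (Filter.Eventually.of_forall fun x => ?_)
    simp only
    rw [← integral_complex_ofReal]
    refine integral_congr_ae (Filter.Eventually.of_forall fun y => ?_)
    simp only
    rw [Complex.ofReal_mul, hσ.covariance_eq, ← integral_const_mul]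
  rw [h1, ← integral_prod (fun p => ∫ ξ, F p ξ ∂σ) hFi.integral_prod_left,
    integral_integral_swap hFi]
  refine integral_congr_ae (Filter.Eventually.of_forall fun ξ => ?_)
  simp only
  rw [← integral_prod_mul (L := ℂ) (fun x => (v x : ℂ) * expSubOne x ξ)
    (fun y => (w y : ℂ) * conj (expSubOne y ξ))]
  refine integral_congr_ae (Filter.Eventually.of_forall fun p => ?_)
  simp only [hF]
  push_cast
  ring

end Covariance

/-! ### Orientations -/

theorem IsOrientation.smul {M : Matrix (Fin 2) (Fin 2) ℝ} {n : Plane} (h : IsOrientation M n)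
    {c : ℝ} (hc : 0 < c) : IsOrientation (c • M) n := by
  have key : ∀ (A : Matrix (Fin 2) (Fin 2) ℝ) (d m : ℝ),
      Module.End.HasEigenvalue (Matrix.toLin' A) m →
      Module.End.HasEigenvalue (Matrix.toLin' (d • A)) (d * m) := by
    intro A d m hm
    obtain ⟨u, hu⟩ := hm.exists_hasEigenvector
    refine Module.End.hasEigenvalue_of_hasEigenvector (x := u)
      ⟨Module.End.mem_eigenspace_iff.2 ?_, hu.2⟩
    rw [map_smul, LinearMap.smul_apply, hu.apply_eq_smul, smul_smul]
  obtain ⟨hn, l, ⟨hl1, hl2⟩, hl3⟩ := h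
  refine ⟨hn, c * l, ⟨key M c l hl1, fun m hm => ?_⟩, ?_⟩
  · have h1 := key (c • M) c⁻¹ m hm
    rw [inv_smul_smul₀ hc.ne'] at h1
    have h2 := hl2 h1
    rwa [inv_mul_le_iff₀ hc] at h2
  · rw [Matrix.smul_mulVec, hl3, smul_smul]

theorem isOrientation_smul_iff {M : Matrix (Fin 2) (Fin 2) ℝ} {n : Plane} {c : ℝ} (hc : 0 < c) :
    IsOrientation (c • M) n ↔ IsOrientation M n := by
  refine ⟨fun h => ?_, fun h => h.smul hc⟩
  have := h.smul (inv_pos.2 hc)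
  rwa [inv_smul_smul₀ hc.ne'] at this

/-! ### The Riesz coefficients -/

section RieszCoefficients

variable {Ω : Type*} [MeasurableSpace Ω] {P : Measure Ω} {X : Plane → Ω → ℝ}

theorem waveletKernel_eq_ofReal (φ : ℝ → ℝ) (i : ℤ) (k : Fin 2 → ℤ) (l : Fin 2) (x : Plane) :
    waveletKernel φ i k l x = ((waveletKernel φ i k l x).re : ℂ) :=
  (Complex.conj_eq_iff_re.1 (conj_waveletKernel φ i k l x)).symm

theorem norm_re_waveletKernel (φ : ℝ → ℝ) (i : ℤ) (k : Fin 2 → ℤ) (l : Fin 2) (x : Plane) :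
    ‖(waveletKernel φ i k l x).re‖ = ‖waveletKernel φ i k l x‖ := by
  rw [← Complex.norm_real, ← waveletKernel_eq_ofReal]

namespace IsRadialProfile

variable {N : ℕ} {φ : ℝ → ℝ} (hφ : IsRadialProfile N φ) (i : ℤ) (k : Fin 2 → ℤ)
  {H : ℝ} (hH0 : 0 < H) (hH1 : H < 1) (hX : IsGaussianField X P) (hself : IsSelfSimilar H X P)

include hφ

theorem continuous_re_waveletKernel (l : Fin 2) :
    Continuous fun x => (waveletKernel φ i k l x).re :=
  Complex.continuous_re.comp (hφ.continuous_waveletKernel i k l)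

include hH0 hH1

theorem integrable_weight_mul_re_waveletKernel (l : Fin 2) :
    Integrable fun x : Plane => (1 + ‖x‖) ^ H * ‖(waveletKernel φ i k l x).re‖ := by
  simp only [norm_re_waveletKernel]
  exact hφ.integrable_weight_mul_waveletKernel i k l hH0.le hH1

include hself

theorem integrable_waveletKernel_smul (l : Fin 2) :
    Integrable fun x => (waveletKernel φ i k l x).re • hX.toRealL2 x :=
  hX.integrable_smul_toRealL2 hH0 hself (hφ.continuous_re_waveletKernel i k l)
    (hφ.integrable_weight_mul_re_waveletKernel i k hH0 hH1 l)

-- The wavelet is real, so the complex integrand is the image of a curve in `L²(Ω; ℝ)`, where the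
-- Gaussian space lives.
omit hH0 hH1 hself in
theorem conj_rieszWavelet_smul_ae_eq (l : Fin 2) :
    (fun x => conj (rieszWavelet hφ i k l x) • hX.toL2 x) =ᵐ[volume]
      fun x => lpOfReal P ((waveletKernel φ i k l x).re • hX.toRealL2 x) := by
  filter_upwards [hφ.rieszWavelet_ae_eq i k l] with x hx
  rw [hx, conj_waveletKernel, map_smul, hX.lpOfReal_toRealL2, waveletKernel_eq_ofReal,
    Complex.ofReal_re]
  exact algebraMap_smul ℂ (waveletKernel φ i k l x).re (hX.toL2 x)

theorem integrable_conj_rieszWavelet_smul (l : Fin 2) :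
    Integrable (fun x => conj (rieszWavelet hφ i k l x) • hX.toL2 x) volume :=
  ((lpOfReal P).integrable_comp
    (hφ.integrable_waveletKernel_smul i k hH0 hH1 hX hself l)).congr
    (hφ.conj_rieszWavelet_smul_ae_eq i k hX l).symm

theorem rieszCoeff_eq (l : Fin 2) :
    rieszCoeff hX hφ i k l =
      lpOfReal P (∫ x, (waveletKernel φ i k l x).re • hX.toRealL2 x) := by
  rw [rieszCoeff, IsGaussianField.pairing,
    integral_congr_ae (hφ.conj_rieszWavelet_smul_ae_eq i k hX l)]
  exact (lpOfReal P).integral_comp_comm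
    (hφ.integrable_waveletKernel_smul i k hH0 hH1 hX hself l)

theorem coeFn_rieszCoeff (l : Fin 2) :
    ∀ᵐ ω ∂P, rieszCoeff hX hφ i k l ω =
      (((∫ x, (waveletKernel φ i k l x).re • hX.toRealL2 x : Lp ℝ 2 P) ω : ℝ) : ℂ) := by
  rw [hφ.rieszCoeff_eq i k hH0 hH1 hX hself l]
  exact coeFn_lpOfReal _

theorem rieszCovariance_apply (a b : Fin 2) :
    rieszCovariance hX hφ i k a b =
      ((∫ x, ∫ y, (waveletKernel φ i k a x).re * (waveletKernel φ i k b y).re *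
        ∫ ω, X x ω * X y ω ∂P : ℝ) : ℂ) := by
  rw [← hX.inner_integral_smul_toRealL2
    (hφ.integrable_waveletKernel_smul i k hH0 hH1 hX hself a)
    (hφ.integrable_waveletKernel_smul i k hH0 hH1 hX hself b), real_inner_eq_integral,
    rieszCovariance, Matrix.of_apply, ← integral_complex_ofReal]
  refine integral_congr_ae ?_
  filter_upwards [hφ.coeFn_rieszCoeff i k hH0 hH1 hX hself a,
    hφ.coeFn_rieszCoeff i k hH0 hH1 hX hself b] with ω h1 h2
  rw [h1, h2, Complex.conj_ofReal, Complex.ofReal_mul]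

/-- The covariance matrix of the Riesz coefficients is a multiple of the structure tensor. -/
theorem rieszCovariance_eq {f : Plane → ℝ} (hf : IsSpectralDensity X P f) {S : Circle1 → ℝ}
    (hS : IsAnisotropyFunction H f S) :
    rieszCovariance hX hφ i k =
      (((2 : ℝ) ^ (-2 * (i : ℝ) * (H + 1)) *
        ∫ r in Ioi (0 : ℝ), |φ r| ^ 2 / r ^ (2 * H + 1)) • structureTensor S).map
        Complex.ofReal := by
  ext a b
  set c : ℝ := ((2 : ℝ) ^ i)⁻¹ with hc
  have hc0 : 0 < c := by positivity
  rw [hφ.rieszCovariance_apply i k hH0 hH1 hX hself,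
    hf.spectral.integral_integral_mul_cov hX hH0 hself
      (hφ.continuous_re_waveletKernel i k a) (hφ.continuous_re_waveletKernel i k b)
      (hφ.integrable_weight_mul_re_waveletKernel i k hH0 hH1 a)
      (hφ.integrable_weight_mul_re_waveletKernel i k hH0 hH1 b)]
  simp only [← waveletKernel_eq_ofReal, conj_expSubOne]
  simp only [expSubOne, hφ.integral_waveletKernel_mul_exp_mul_conj]
  rw [integral_complex_ofReal, Matrix.map_apply, Matrix.smul_apply]
  congr 1
  rw [integral_withDensity_ofReal hf.measurable hf.nonneg]
  -- The coordinate quotients depend on the direction alone, so the homogeneity of `f` separates the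
  -- integrand into an angular and a radial factor.
  have hpolar : ∀ᵐ ξ : Plane, ∀ Θ : Circle1, ξ = ‖ξ‖ • (Θ : Plane) →
      f ξ • ((((2 : ℝ) ^ i) ^ 2)⁻¹ * (ξ a / ‖ξ‖) * (ξ b / ‖ξ‖) * φ (c * ‖ξ‖) ^ 2) =
        ((Θ : Plane) a * (Θ : Plane) b * S Θ) *
          (fun r => c ^ 2 * (r ^ (-2 * H - 2) * φ (c * r) ^ 2)) ‖ξ‖ := by
    have h0 : ∀ᵐ ξ : Plane, ξ ≠ 0 := by simp [ae_iff]
    filter_upwards [hS.eq, h0] with ξ hξ hne Θ hΘ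
    have hn : ‖ξ‖ ≠ 0 := norm_ne_zero_iff.2 hne
    have hcoord : ∀ j : Fin 2, ξ j / ‖ξ‖ = (Θ : Plane) j := fun j => by
      have h1 : ξ j = ‖ξ‖ * (Θ : Plane) j := by
        conv_lhs => rw [hΘ]
        simp
      rw [h1, mul_div_cancel_left₀ _ hn]
    rw [hξ Θ hΘ, hcoord, hcoord, smul_eq_mul, hc, inv_pow]
    ring
  have key := integral_polar (A := fun Θ : Circle1 => (Θ : Plane) a * (Θ : Plane) b * S Θ)
    (B := fun r => c ^ 2 * (r ^ (-2 * H - 2) * φ (c * r) ^ 2)) hpolar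
  refine (by simpa only [← hc] using key : _ = _).trans ?_
  rw [smul_eq_mul, mul_comm (∫ Θ, _ ∂arcLength)]
  congr 1
  -- The area factor `r` raises the exponent `-2H-2` to `-(2H+1)`.
  have e : ∀ r ∈ Ioi (0 : ℝ), r * (c ^ 2 * (r ^ (-2 * H - 2) * φ (c * r) ^ 2)) =
      c ^ 2 * (|φ (c * r)| ^ 2 / r ^ (2 * H + 1)) := fun r hr => by
    have hr0 : (0 : ℝ) < r := hr
    have h1 : r * r ^ (-2 * H - 2) = (r ^ (2 * H + 1))⁻¹ := by
      rw [← Real.rpow_neg hr0.le]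
      nth_rewrite 1 [← Real.rpow_one r]
      rw [← Real.rpow_add hr0]
      congr 1
      ring
    rw [sq_abs, div_eq_mul_inv, ← h1]
    ring
  rw [setIntegral_congr_fun measurableSet_Ioi e, integral_const_mul,
    integral_sq_comp_mul_div_rpow φ hc0, ← mul_assoc]
  congr 1
  -- What remains is `c² c^{2H} = 2^{-2i(H+1)}` for `c = 2^{-i}`.
  rw [hc, ← Real.rpow_intCast, ← Real.rpow_neg (by norm_num), ← Real.rpow_natCast,
    ← Real.rpow_mul (by norm_num), ← Real.rpow_mul (by norm_num), ← Real.rpow_add (by norm_num)]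
  congr 1
  push_cast
  ring

end IsRadialProfile

end RieszCoefficients

theorem mainTheorem1 {Ω : Type*} [MeasurableSpace Ω] (P : Measure Ω) [IsProbabilityMeasure P]
    (H : ℝ) (hH0 : 0 < H) (hH1 : H < 1)
    (X : Plane → Ω → ℝ) (hX : IsGaussianField X P)
    (hstat : HasStationaryIncrements X P) (hself : IsSelfSimilar H X P)
    (f : Plane → ℝ) (hf : IsSpectralDensity X P f) :
    (∃ S : Circle1 → ℝ, IsAnisotropyFunction H f S) ∧
    (∀ S : Circle1 → ℝ, IsAnisotropyFunction H f S →
      Integrable S arcLength ∧ (structureTensor S).PosSemidef) ∧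
    ∀ (N : ℕ) (φ : ℝ → ℝ) (hφ : IsRadialProfile N φ) (i : ℤ) (k : Fin 2 → ℤ),
      (∀ l, Integrable (fun x => conj (rieszWavelet hφ i k l x) • hX.toL2 x) volume) ∧
      (∀ l, ∀ᵐ ω ∂P, (rieszCoeff hX hφ i k l ω).im = 0) ∧
      HasGaussianLaw (fun ω (l : Fin 2) => (rieszCoeff hX hφ i k l ω).re) P ∧
      (∀ l, ∫ ω, rieszCoeff hX hφ i k l ω ∂P = 0) ∧
      IntegrableOn (fun r : ℝ => |φ r| ^ 2 / r ^ (2 * H + 1)) (Ioi 0) volume ∧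
      0 < ∫ r in Ioi (0 : ℝ), |φ r| ^ 2 / r ^ (2 * H + 1) ∧
      ∀ S : Circle1 → ℝ, IsAnisotropyFunction H f S →
        rieszCovariance hX hφ i k =
          (((2 : ℝ) ^ (-2 * (i : ℝ) * (H + 1)) *
            ∫ r in Ioi (0 : ℝ), |φ r| ^ 2 / r ^ (2 * H + 1)) • structureTensor S).map
            Complex.ofReal ∧
        ∀ n : Plane, IsOrientation (structureTensor S) n ↔
          IsOrientation ((rieszCovariance hX hφ i k).map Complex.re) n := by
  refine ⟨hf.exists_isAnisotropyFunction hself, fun S hS => ?_, fun N φ hφ i k => ?_⟩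
  · have hSi := hS.integrable
      ((lintegral_withDensity_min_lt_top_iff hf.measurable hf.nonneg).1 hf.spectral.finite)
    exact ⟨hSi, posSemidef_structureTensor hSi hS.nonneg⟩
  · have hcoeff := hφ.coeFn_rieszCoeff i k hH0 hH1 hX hself
    have hmem : ∀ l, (∫ x, (waveletKernel φ i k l x).re • hX.toRealL2 x) ∈ hX.gaussianSpace :=
      fun l => hX.integral_mem_gaussianSpace
        (hφ.integrable_waveletKernel_smul i k hH0 hH1 hX hself l)
    have hpos := hφ.integral_sq_div_rpow_pos hH1
    refine ⟨hφ.integrable_conj_rieszWavelet_smul i k hH0 hH1 hX hself, fun l => ?_, ?_,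
      fun l => ?_, hφ.integrableOn_sq_div_rpow hH1, hpos, fun S hS => ?_⟩
    · filter_upwards [hcoeff l] with ω hω
      rw [hω, Complex.ofReal_im]
    · refine (hX.hasGaussianLaw_of_mem_gaussianSpace hmem).congr ?_
      filter_upwards [ae_all_iff.2 hcoeff] with ω hω
      funext l
      rw [hω l, Complex.ofReal_re]
    · rw [integral_congr_ae (hcoeff l), integral_complex_ofReal,
        (hX.charFun_of_mem_gaussianSpace (hmem l)).1, Complex.ofReal_zero]
    · have hcov := hφ.rieszCovariance_eq i k hH0 hH1 hX hself hf hS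
      refine ⟨hcov, fun n => ?_⟩
      have hre : ∀ M : Matrix (Fin 2) (Fin 2) ℝ, (M.map Complex.ofReal).map Complex.re = M :=
        fun M => by ext; simp
      rw [hcov, hre]
      exact (isOrientation_smul_iff (mul_pos (by positivity) hpos)).symm
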